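/- Let $N\ge 1$ and let $\Omega\subset\mathbb{R}^N$ be a bounded domain (a non-empty connected open set) with $C^1$ boundary and outward unit normal $\nu$. Let $\alpha,\beta\ge 0$ and $f,g\in C^1(\mathbb{R})$, and put $F(t)=\int_0^t f(s)\,ds$, $G(t)=\int_0^t g(s)\,ds$. Let $u,v\in C^2(\Omega)\cap C^1(\overline\Omega)$ be non-negative and satisfy $$-\Delta u=|x|^\alpha f(v),\qquad -\Delta v=|x|^\beta g(u)\quad\text{in }\Omega,\qquad u=v=0\quad\text{on }\partial\Omega.$$ Then for every $\tau\in[0,1]$ the following integrals converge absolutely and $$\int_\Omega\big((N+\alpha)F(v)-(N-2)\,\tau\, v f(v)\big)|x|^\alpha\,dx+\int_\Omega\big((N+\beta)G(u)-(N-2)(1-\tau)\,u g(u)\big)|x|^\beta\,dx=\int_{\partial\Omega}(x\cdot\nu)\,\partial_\nu u\,\partial_\nu v\,dS,$$ where $dS$ is the $(N-1)$-dimensional surface measure on $\partial\Omega$. -/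

import Mathlib

open scoped MeasureTheory Laplacian RealInnerProductSpace Topology

namespace WeightedElliptic

/-- Near `x`, the set `Ω` is the region strictly above the graph of the `C¹` function `γ` in the
direction of the unit vector `e`. Invariance of `γ` along `e` says that `γ` is a function of the
coordinates orthogonal to `e` only. -/
structure IsC1GraphAt {N : ℕ} (Ω : Set (EuclideanSpace ℝ (Fin N)))
    (x e : EuclideanSpace ℝ (Fin N)) (γ : EuclideanSpace ℝ (Fin N) → ℝ) : Prop where
  norm_eq_one : ‖e‖ = 1
  contDiff : ContDiff ℝ 1 γ
  invariant : ∀ (y : EuclideanSpace ℝ (Fin N)) (t : ℝ), γ (y + t • e) = γ y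
  mem_iff : ∀ᶠ y in 𝓝 x, y ∈ Ω ↔ γ y < ⟪e, y⟫

/-- `Ω` has a `C¹` boundary: near each of its boundary points it is, in suitable orthonormal
coordinates, the region above the graph of a `C¹` function. -/
def HasC1Boundary {N : ℕ} (Ω : Set (EuclideanSpace ℝ (Fin N))) : Prop :=
  ∀ x ∈ frontier Ω, ∃ e γ, IsC1GraphAt Ω x e γ

/-- `n` is the outward unit normal to `Ω` at the boundary point `x`: in graph coordinates with
vertical direction `e`, it is `(∇γ(x), -1)` divided by its norm `√(1 + |∇γ(x)|²)`. -/
def IsOutwardUnitNormal {N : ℕ} (Ω : Set (EuclideanSpace ℝ (Fin N)))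
    (x n : EuclideanSpace ℝ (Fin N)) : Prop :=
  ∃ e γ, IsC1GraphAt Ω x e γ ∧ n = ‖gradient γ x - e‖⁻¹ • (gradient γ x - e)

lemma IsC1GraphAt.sub_ne_zero {N : ℕ} {Ω : Set (EuclideanSpace ℝ (Fin N))}
    {x e : EuclideanSpace ℝ (Fin N)} {γ : EuclideanSpace ℝ (Fin N) → ℝ}
    (h : IsC1GraphAt Ω x e γ) : gradient γ x - e ≠ 0 := by
  have hd : DifferentiableAt ℝ γ x := h.contDiff.differentiable one_ne_zero x
  have h1 : HasDerivAt (fun t : ℝ => γ (x + t • e)) (fderiv ℝ γ x e) 0 := by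
    have hl : HasDerivAt (fun t : ℝ => x + t • e) e 0 := by
      simpa using ((hasDerivAt_id (0 : ℝ)).smul_const e).const_add x
    have hx : HasFDerivAt γ (fderiv ℝ γ x) (x + (0 : ℝ) • e) := by
      simpa using hd.hasFDerivAt
    exact hx.comp_hasDerivAt 0 hl
  have h2 : HasDerivAt (fun t : ℝ => γ (x + t • e)) 0 0 := by
    simp only [h.invariant]
    exact hasDerivAt_const _ _
  have h3 : fderiv ℝ γ x e = 0 := h1.unique h2
  have h4 : ⟪gradient γ x, e⟫ = 0 := by
    rw [gradient, InnerProductSpace.toDual_symm_apply, h3]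
  intro h0
  rw [sub_eq_zero.1 h0, real_inner_self_eq_norm_sq, h.norm_eq_one] at h4
  norm_num at h4

lemma IsC1GraphAt.hasDerivAt {N : ℕ} {Ω : Set (EuclideanSpace ℝ (Fin N))}
    {x e : EuclideanSpace ℝ (Fin N)} {γ : EuclideanSpace ℝ (Fin N) → ℝ}
    (h : IsC1GraphAt Ω x e γ) (d : EuclideanSpace ℝ (Fin N)) :
    HasDerivAt (fun t : ℝ => γ (x + t • d) - ⟪e, x + t • d⟫) ⟪gradient γ x - e, d⟫ 0 := by
  have hd : DifferentiableAt ℝ γ x := h.contDiff.differentiable one_ne_zero x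
  have hl : HasDerivAt (fun t : ℝ => x + t • d) d 0 := by
    simpa using ((hasDerivAt_id (0 : ℝ)).smul_const d).const_add x
  have hx : HasFDerivAt γ (fderiv ℝ γ x) (x + (0 : ℝ) • d) := by
    simpa using hd.hasFDerivAt
  have h1 := hx.comp_hasDerivAt 0 hl
  have h2 := (innerSL ℝ e).hasFDerivAt.comp_hasDerivAt (0 : ℝ) hl
  have h3 := h1.sub h2
  rw [inner_sub_left, gradient, InnerProductSpace.toDual_symm_apply]
  exact h3

lemma IsC1GraphAt.eq_inner {N : ℕ} {Ω : Set (EuclideanSpace ℝ (Fin N))}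
    {x e : EuclideanSpace ℝ (Fin N)} {γ : EuclideanSpace ℝ (Fin N) → ℝ}
    (h : IsC1GraphAt Ω x e γ) (hx : x ∈ frontier Ω) : γ x = ⟪e, x⟫ := by
  have hc : Continuous γ := h.contDiff.continuous
  have hi : Continuous fun y : EuclideanSpace ℝ (Fin N) => ⟪e, y⟫ := by fun_prop
  rcases lt_trichotomy (γ x) ⟪e, x⟫ with hlt | heq | hgt
  · exfalso
    have h1 : ∀ᶠ y in 𝓝 x, γ y < ⟪e, y⟫ := hc.continuousAt.eventually_lt hi.continuousAt hlt
    refine hx.2 (mem_interior_iff_mem_nhds.2 ?_)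
    filter_upwards [h1, h.mem_iff] with y hy hm using hm.2 hy
  · exact heq
  · exfalso
    have h1 : ∀ᶠ y in 𝓝 x, ⟪e, y⟫ < γ y := hi.continuousAt.eventually_lt hc.continuousAt hgt
    have h2 : ∃ᶠ y in 𝓝 x, y ∈ Ω := mem_closure_iff_frequently.1 hx.1
    obtain ⟨y, hy, h3, hm⟩ := (h2.and_eventually (h1.and h.mem_iff)).exists
    exact absurd (hm.1 hy) h3.not_gt

/-- The outward unit normal at a boundary point does not depend on the graph coordinates. -/
lemma IsOutwardUnitNormal.unique {N : ℕ} {Ω : Set (EuclideanSpace ℝ (Fin N))}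
    {x n n' : EuclideanSpace ℝ (Fin N)} (hx : x ∈ frontier Ω)
    (h : IsOutwardUnitNormal Ω x n) (h' : IsOutwardUnitNormal Ω x n') : n = n' := by
  obtain ⟨e, γ, hg, hn⟩ := h
  obtain ⟨e', γ', hg', hn'⟩ := h'
  have hw := norm_pos_iff.2 hg.sub_ne_zero
  have hw' := norm_pos_iff.2 hg'.sub_ne_zero
  have n1 : ‖n‖ = 1 := by
    rw [hn, norm_smul, norm_inv, norm_norm, inv_mul_cancel₀ hw.ne']
  have n1' : ‖n'‖ = 1 := by
    rw [hn', norm_smul, norm_inv, norm_norm, inv_mul_cancel₀ hw'.ne']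
  have ew : gradient γ x - e = ‖gradient γ x - e‖ • n := by
    rw [hn, smul_smul, mul_inv_cancel₀ hw.ne', one_smul]
  have ew' : gradient γ' x - e' = ‖gradient γ' x - e'‖ • n' := by
    rw [hn', smul_smul, mul_inv_cancel₀ hw'.ne', one_smul]
  by_contra hne
  have hlt : ⟪n, n'⟫ < 1 := by
    rw [inner_lt_one_iff_real_of_norm_eq_one n1 n1']
    exact hne
  have s1 : ⟪gradient γ x - e, n' - n⟫ < 0 := by
    rw [ew, real_inner_smul_left, inner_sub_right, real_inner_self_eq_norm_sq, n1]
    exact mul_neg_of_pos_of_neg hw (by linarith)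
  have s2 : 0 < ⟪gradient γ' x - e', n' - n⟫ := by
    rw [ew', real_inner_smul_left, inner_sub_right, real_inner_self_eq_norm_sq, n1',
      real_inner_comm]
    exact mul_pos hw' (by linarith)
  have d1 := hg.hasDerivAt (n' - n)
  have d2 := hg'.hasDerivAt (n' - n)
  have hl : Filter.Tendsto (fun t : ℝ => x + t • (n' - n)) (𝓝[>] 0) (𝓝 x) := by
    have : Continuous fun t : ℝ => x + t • (n' - n) := by fun_prop
    have := this.tendsto 0
    simp only [zero_smul, add_zero] at this
    exact this.mono_left nhdsWithin_le_nhds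
  have q1 := (hasDerivWithinAt_iff_tendsto_slope' (by simp)).1
    (d1.hasDerivWithinAt (s := Set.Ioi 0))
  have q2 := (hasDerivWithinAt_iff_tendsto_slope' (by simp)).1
    (d2.hasDerivWithinAt (s := Set.Ioi 0))
  obtain ⟨t, ht, t1, t2, m1, m2⟩ := ((eventually_mem_nhdsWithin (a := (0 : ℝ)) (s := Set.Ioi 0)).and
    ((q1.eventually_lt_const s1).and ((q2.eventually_const_lt s2).and
      ((hl.eventually hg.mem_iff).and (hl.eventually hg'.mem_iff))))).exists
  have ht : (0 : ℝ) < t := ht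
  simp only [slope_def_field, zero_smul, add_zero, hg.eq_inner hx, hg'.eq_inner hx, sub_self,
    sub_zero] at t1 t2
  have r1 := (div_neg_iff.1 t1).resolve_left (fun h => absurd h.2 ht.not_gt)
  have r2 := (div_pos_iff_of_pos_right ht).1 t2
  have r3 := m2.1 (m1.2 (by linarith [r1.1]))
  linarith

open Classical in
/-- The outward unit normal `ν` on the boundary of a set with `C¹` boundary (and `0` at the points
where there is none). -/
noncomputable def outwardNormal {N : ℕ} (Ω : Set (EuclideanSpace ℝ (Fin N)))
    (x : EuclideanSpace ℝ (Fin N)) : EuclideanSpace ℝ (Fin N) :=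
  if h : ∃ n, IsOutwardUnitNormal Ω x n then h.choose else 0

lemma HasC1Boundary.isOutwardUnitNormal {N : ℕ} {Ω : Set (EuclideanSpace ℝ (Fin N))}
    (hΩ : HasC1Boundary Ω) {x : EuclideanSpace ℝ (Fin N)} (hx : x ∈ frontier Ω) :
    IsOutwardUnitNormal Ω x (outwardNormal Ω x) := by
  have h : ∃ n, IsOutwardUnitNormal Ω x n := by
    obtain ⟨e, γ, hg⟩ := hΩ x hx
    exact ⟨_, e, γ, hg, rfl⟩
  rw [outwardNormal, dif_pos h]
  exact h.choose_spec

/-- The outward normal derivative `∂_ν u` at a boundary point of `Ω`, for `u` of class `C¹` up to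
the boundary. -/
noncomputable def normalDeriv {N : ℕ} (Ω : Set (EuclideanSpace ℝ (Fin N)))
    (u : EuclideanSpace ℝ (Fin N) → ℝ) (x : EuclideanSpace ℝ (Fin N)) : ℝ :=
  fderivWithin ℝ u (closure Ω) x (outwardNormal Ω x)

/-- The antiderivative `t ↦ ∫₀ᵗ f(s) ds`. -/
noncomputable def antideriv (f : ℝ → ℝ) (t : ℝ) : ℝ :=
  ∫ s in (0 : ℝ)..t, f s

/-- `(u, v)` is a non-negative classical solution, in `C²(Ω) ∩ C¹(Ω̄)`, of
`-Δu = |x|^α f(v)`, `-Δv = |x|^β g(u)` in `Ω`, `u = v = 0` on `∂Ω`. -/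
structure IsNonnegSolution {N : ℕ} (Ω : Set (EuclideanSpace ℝ (Fin N))) (α β : ℝ) (f g : ℝ → ℝ)
    (u v : EuclideanSpace ℝ (Fin N) → ℝ) : Prop where
  contDiffOn_u : ContDiffOn ℝ 2 u Ω
  contDiffOn_v : ContDiffOn ℝ 2 v Ω
  contDiffOn_closure_u : ContDiffOn ℝ 1 u (closure Ω)
  contDiffOn_closure_v : ContDiffOn ℝ 1 v (closure Ω)
  nonneg_u : ∀ x ∈ Ω, 0 ≤ u x
  nonneg_v : ∀ x ∈ Ω, 0 ≤ v x
  eq_u : ∀ x ∈ Ω, -(Δ u) x = ‖x‖ ^ α * f (v x)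
  eq_v : ∀ x ∈ Ω, -(Δ v) x = ‖x‖ ^ β * g (u x)
  boundary_u : ∀ x ∈ frontier Ω, u x = 0
  boundary_v : ∀ x ∈ frontier Ω, v x = 0

end WeightedElliptic

/-! The identity is the divergence theorem applied to `pohozaevField`, a sum of three groups. The
Rellich field (x·∇u)∇v + (x·∇v)∇u − (∇u·∇v)x has divergence (x·∇u)Δv + (x·∇v)Δu + (2−N)∇u·∇v,
because the Hessian terms cancel by symmetry (`divergence_rellich`). Adding F(v)|x|^α x + G(u)|x|^β
x cancels, through the equations, the terms in x·∇u and x·∇v and produces (N+α)F(v)|x|^α and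
(N+β)G(u)|x|^β. Adding (N−2)(τ v∇u + (1−τ)u∇v) cancels ∇u·∇v, since the weights τ and 1−τ have sum
1, and produces the terms in v f(v) and u g(u). On the boundary u = v = 0, so both gradients are
normal (`closureGradient_eq_smul_normal`) and the flux is (x·ν)∂_νu ∂_νv.

Second derivatives of u and v may blow up at the boundary, but the divergence of the field contains
none of them and extends continuously. The version of the divergence theorem that fits is
`integral_divergence_eq_integral_frontier`: the field is C¹ inside, and only the field and its
divergence need be continuous up to the boundary. After localization by bump functions, a cutoff in
the height h above the graph makes the field C¹ with compact support in the whole space, where the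
integral of a divergence is zero. As the cutoff width tends to 0, its gradient concentrates on the
graph. The area formula for graphs (`comap_graphMap`) turns the limit into an integral for the
Hausdorff measure `μHE[N - 1]`. -/

namespace WeightedElliptic

open MeasureTheory Set Filter Module

open scoped NNReal ENNReal

/-! ### Area formula for expanding C¹ maps. -/

section AreaFormula

/-- On `s` the hypothesis makes `p` factor through `q` by a `K`-Lipschitz map, even when `q` is not
injective. -/
lemma euclideanHausdorffMeasure_image_le_of_dist_le {A X Y : Type*}
    [MetricSpace X] [MeasurableSpace X] [BorelSpace X]
    [MetricSpace Y] [MeasurableSpace Y] [BorelSpace Y]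
    {p : A → X} {q : A → Y} {s : Set A} {K : ℝ≥0} (d : ℕ)
    (h : ∀ x ∈ s, ∀ y ∈ s, dist (p x) (p y) ≤ K * dist (q x) (q y)) :
    μHE[d] (p '' s) ≤ (K : ℝ≥0∞) ^ d * μHE[d] (q '' s) := by
  rcases s.eq_empty_or_nonempty with rfl | ⟨a, ha⟩
  · simp
  have : Nonempty A := ⟨a⟩
  set r := Function.invFunOn q s
  have hr : ∀ x ∈ s, r (q x) ∈ s ∧ q (r (q x)) = q x := fun x hx =>
    ⟨Function.invFunOn_mem ⟨x, hx, rfl⟩, Function.invFunOn_eq ⟨x, hx, rfl⟩⟩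
  have himg : p '' s = (p ∘ r) '' (q '' s) := by
    rw [image_image]
    refine image_congr fun x hx => ?_
    have h1 := h x hx _ (hr x hx).1
    rw [(hr x hx).2, dist_self, mul_zero] at h1
    exact dist_le_zero.1 h1
  have hlip : LipschitzOnWith K (p ∘ r) (q '' s) := by
    refine LipschitzOnWith.of_dist_le_mul ?_
    rintro _ ⟨x, hx, rfl⟩ _ ⟨y, hy, rfl⟩
    have h1 := h _ (hr x hx).1 _ (hr y hy).1
    rwa [(hr x hx).2, (hr y hy).2] at h1
  have := hlip.hausdorffMeasure_image_le (d := (d : ℝ)) d.cast_nonneg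
  rw [himg]
  simp only [Measure.euclideanHausdorffMeasure_def, Measure.smul_apply, Measure.nnreal_smul_coe_apply]
  rw [ENNReal.rpow_natCast] at this
  calc _ ≤ _ * ((K : ℝ≥0∞) ^ d * _) := by gcongr
    _ = _ := mul_left_comm _ _ _

/-- Countably many of the neighbourhoods cover the space; making them disjoint reduces the claim to
countable additivity. -/
lemma measure_le_smul_of_locally {X : Type*} [TopologicalSpace X] [SecondCountableTopology X]
    [MeasurableSpace X] [OpensMeasurableSpace X] {μ ν : Measure X} {c : ℝ≥0∞}
    (h : ∀ x, ∃ U ∈ 𝓝 x, ∀ A ⊆ U, MeasurableSet A → μ A ≤ c * ν A) : μ ≤ c • ν := by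
  choose U hU hA using h
  obtain ⟨t, ht, htU⟩ := TopologicalSpace.countable_cover_nhds
    (fun x => interior_mem_nhds.2 (hU x))
  rcases isEmpty_or_nonempty X with hX | hX
  · intro s; simp [s.eq_empty_of_isEmpty]
  have hne : t.Nonempty := by
    rw [nonempty_iff_ne_empty]
    rintro rfl
    simp at htU
    exact empty_ne_univ htU
  obtain ⟨x, rfl⟩ := ht.exists_eq_range hne
  rw [biUnion_range] at htU
  refine Measure.le_iff.2 fun s hs => ?_
  set B : ℕ → Set X := disjointed fun i => interior (U (x i))
  have hB : ∀ i, MeasurableSet (B i) :=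
    MeasurableSet.disjointed fun i => isOpen_interior.measurableSet
  have hdec : s = ⋃ i, s ∩ B i := by
    rw [← inter_iUnion, iUnion_disjointed, htU, inter_univ]
  have hdis : Pairwise (Function.onFun Disjoint fun i => s ∩ B i) := fun i j hij =>
    (disjoint_disjointed _ hij).mono inter_subset_right inter_subset_right
  rw [Measure.smul_apply, smul_eq_mul, hdec, measure_iUnion hdis fun i => hs.inter (hB i),
    measure_iUnion hdis fun i => hs.inter (hB i), ← ENNReal.tsum_mul_left]
  refine ENNReal.tsum_le_tsum fun i => hA (x i) _ ?_ (hs.inter (hB i))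
  exact inter_subset_right.trans ((disjointed_subset _ i).trans interior_subset)

lemma measure_le_of_forall_smul {X : Type*} [MeasurableSpace X] {μ ν : Measure X} (d : ℕ)
    (h : ∀ K : ℝ≥0, 1 < K → μ ≤ ((K : ℝ≥0∞) ^ d) • ν) : μ ≤ ν := by
  refine Measure.le_iff.2 fun s _ => ?_
  have h1 : Tendsto (fun K : ℝ≥0 => (K : ℝ≥0∞) ^ d * ν s) (𝓝[>] 1)
      (𝓝 (((1 : ℝ≥0) : ℝ≥0∞) ^ d * ν s)) := by
    refine Tendsto.mono_left ?_ nhdsWithin_le_nhds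
    refine ENNReal.Tendsto.mul_const ?_ (Or.inl (by simp))
    exact ((ENNReal.continuous_pow d).comp ENNReal.continuous_coe).tendsto 1
  have : (𝓝[>] (1 : ℝ≥0)).NeBot := nhdsGT_neBot _
  have := ge_of_tendsto h1 (eventually_mem_nhdsWithin.mono fun K hK => h K hK s)
  simpa using this

variable {U V : Type*} [NormedAddCommGroup U] [InnerProductSpace ℝ U] [FiniteDimensional ℝ U]
  [MeasurableSpace U] [BorelSpace U] [NormedAddCommGroup V] [InnerProductSpace ℝ V]
  [MeasurableSpace V] [BorelSpace V]

/-- The area formula for an expanding `C¹` map. -/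
theorem comap_euclideanHausdorffMeasure_eq_withDensity {Φ : U → V} {Φ' : U → U →L[ℝ] V}
    {J : U → ℝ} (hΦ : ∀ y, HasStrictFDerivAt Φ (Φ' y) y)
    (hanti : ∀ x y, ‖x - y‖ ≤ ‖Φ x - Φ y‖) (hanti' : ∀ y z, ‖z‖ ≤ ‖Φ' y z‖)
    (hJ : ∀ y, J y = (Φ' y).toLinearMap.normDet) (hJc : Continuous J) (hJpos : ∀ y, 0 < J y)
    (hemb : MeasurableEmbedding Φ) :
    (μHE[finrank ℝ U]).comap Φ = volume.withDensity fun y => ENNReal.ofReal (J y) := by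
  set d := finrank ℝ U
  -- Near y₀ the map and its linearization are comparable up to the factor K: strict
  -- differentiability gives an error (K−1)‖x−y‖, and the two expansion bounds make it a relative
  -- error.
  have key : ∀ K : ℝ≥0, 1 < K → ∀ y₀, ∃ W ∈ 𝓝 y₀,
      (∀ x ∈ W, ∀ y ∈ W, dist (Φ x) (Φ y) ≤ K * dist (Φ' y₀ x) (Φ' y₀ y)) ∧
      (∀ x ∈ W, ∀ y ∈ W, dist (Φ' y₀ x) (Φ' y₀ y) ≤ K * dist (Φ x) (Φ y)) ∧
      (∀ y ∈ W, J y ≤ K * J y₀) ∧ (∀ y ∈ W, J y₀ ≤ K * J y) := by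
    intro K hK y₀
    have hK' : (1 : ℝ) < K := hK
    obtain ⟨s, hs, happ⟩ := (hΦ y₀).approximates_deriv_on_nhds (c := K - 1)
      (Or.inr (tsub_pos_of_lt hK))
    have h1 : ∀ᶠ y in 𝓝 y₀, J y < K * J y₀ :=
      hJc.continuousAt.eventually_lt continuousAt_const (by nlinarith [hJpos y₀])
    have h2 : ∀ᶠ y in 𝓝 y₀, J y₀ < K * J y :=
      continuousAt_const.eventually_lt (hJc.const_mul _).continuousAt (by nlinarith [hJpos y₀])
    have hcoe : ((K - 1 : ℝ≥0) : ℝ) = K - 1 := by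
      rw [NNReal.coe_sub hK.le, NNReal.coe_one]
    have hb : ∀ x ∈ s, ∀ y ∈ s, ‖Φ x - Φ y - Φ' y₀ (x - y)‖ ≤ (K - 1) * ‖x - y‖ := by
      intro x hx y hy
      simpa [hcoe] using happ x hx y hy
    refine ⟨s ∩ {y | J y < K * J y₀ ∧ J y₀ < K * J y}, inter_mem hs (h1.and h2), ?_, ?_,
      fun y hy => hy.2.1.le, fun y hy => hy.2.2.le⟩
    · intro x hx y hy
      rw [dist_eq_norm, dist_eq_norm, ← map_sub]
      have a1 := hb x hx.1 y hy.1
      have a2 := norm_le_norm_add_norm_sub' (Φ x - Φ y) (Φ' y₀ (x - y))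
      have a3 := hanti' y₀ (x - y)
      nlinarith
    · intro x hx y hy
      rw [dist_eq_norm, dist_eq_norm, ← map_sub]
      have a1 := hb x hx.1 y hy.1
      have a2 := norm_le_norm_add_norm_sub (Φ x - Φ y) (Φ' y₀ (x - y))
      have a3 := hanti x y
      nlinarith
  have lin : ∀ (y₀ : U) (A : Set U), μHE[d] (Φ' y₀ '' A) = ENNReal.ofReal (J y₀) * volume A := by
    intro y₀ A
    rw [hJ]
    exact LinearMap.euclideanHausdorffMeasure_image_eq_normDet_mul_volume (Φ' y₀).toLinearMap A
  have ofK : ∀ (K : ℝ≥0) (a b : ℝ), a ≤ K * b →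
      ENNReal.ofReal a ≤ (K : ℝ≥0∞) * ENNReal.ofReal b := by
    intro K a b h
    rw [← ENNReal.ofReal_coe_nnreal, ← ENNReal.ofReal_mul K.coe_nonneg]
    exact ENNReal.ofReal_le_ofReal h
  -- The exponent d + 1 counts d factors K from the Hausdorff measure and one from the variation of
  -- J.
  refine le_antisymm (measure_le_of_forall_smul (d + 1) fun K hK =>
    measure_le_smul_of_locally fun y₀ => ?_) (measure_le_of_forall_smul (d + 1) fun K hK =>
    measure_le_smul_of_locally fun y₀ => ?_)
  · obtain ⟨W, hW, h1, -, -, h4⟩ := key K hK y₀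
    refine ⟨W, hW, fun A hA hAm => ?_⟩
    rw [hemb.comap_apply, withDensity_apply _ hAm]
    calc μHE[d] (Φ '' A) ≤ (K : ℝ≥0∞) ^ d * μHE[d] (Φ' y₀ '' A) :=
          euclideanHausdorffMeasure_image_le_of_dist_le d
            fun x hx y hy => h1 x (hA hx) y (hA hy)
      _ = (K : ℝ≥0∞) ^ d * ∫⁻ _ in A, ENNReal.ofReal (J y₀) := by
          rw [lin, setLIntegral_const]
      _ ≤ (K : ℝ≥0∞) ^ d * ∫⁻ y in A, K * ENNReal.ofReal (J y) := by
          gcongr 1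
          exact setLIntegral_mono' hAm fun y hy => ofK _ _ _ (h4 y (hA hy))
      _ = _ := by
          rw [lintegral_const_mul _ (by fun_prop), pow_succ, mul_assoc]
  · obtain ⟨W, hW, -, h2, h3, -⟩ := key K hK y₀
    refine ⟨W, hW, fun A hA hAm => ?_⟩
    rw [hemb.comap_apply, withDensity_apply _ hAm]
    calc ∫⁻ y in A, ENNReal.ofReal (J y) ≤ ∫⁻ _ in A, K * ENNReal.ofReal (J y₀) :=
          setLIntegral_mono' hAm fun y hy => ofK _ _ _ (h3 y (hA hy))
      _ = K * μHE[d] (Φ' y₀ '' A) := by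
          rw [lin, setLIntegral_const, mul_assoc]
      _ ≤ K * ((K : ℝ≥0∞) ^ d * μHE[d] (Φ '' A)) := by
          gcongr 1
          exact euclideanHausdorffMeasure_image_le_of_dist_le d
            fun x hx y hy => h2 x (hA hx) y (hA hy)
      _ = _ := by
          rw [pow_succ, mul_comm _ (K : ℝ≥0∞), mul_assoc]

end AreaFormula

/-! ### The Jacobian of a graph parametrization. -/

section NormDet

variable {U V : Type*} [NormedAddCommGroup U] [InnerProductSpace ℝ U] [FiniteDimensional ℝ U]
  [NormedAddCommGroup V] [InnerProductSpace ℝ V]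

/-- The norm determinant of the differential `z ↦ ι z + ⟪w, ι z⟫ e` of a graph. -/
lemma normDet_graph (ι : U →ₗᵢ[ℝ] V) (L : U →ₗ[ℝ] V) {w e : V} (he : ‖e‖ = 1)
    (hιe : ∀ z, ⟪e, ι z⟫ = 0) (hw : w ∈ LinearMap.range ι.toLinearMap)
    (hL : ∀ z, L z = ι z + ⟪w, ι z⟫ • e) : L.normDet = ‖w - e‖ := by
  obtain ⟨w', rfl⟩ := hw
  change ∀ z, L z = ι z + ⟪ι w', ι z⟫ • e at hL
  have hw0 : ⟪ι w', e⟫ = 0 := by rw [real_inner_comm, hιe]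
  have hnorm : ‖ι w' - e‖ ^ 2 = 1 + ‖w'‖ ^ 2 := by
    rw [norm_sub_sq_real, hw0, he, ι.norm_map]
    ring
  rw [← sq_eq_sq₀ (LinearMap.normDet_nonneg _) (norm_nonneg _)]
  change _ = ‖ι w' - e‖ ^ 2
  rw [hnorm]
  set b := stdOrthonormalBasis ℝ U
  have h1 := LinearMap.normDet_sq_eq_det_gram L b
  simp only [RCLike.ofReal_real_eq_id, id] at h1
  rw [h1]
  -- The Gram matrix is a rank-one perturbation of the identity, so its determinant is 1 + ‖w'‖².
  have h2 : Matrix.gram ℝ (fun i => L (b i)) = 1 + Matrix.replicateCol Unit (fun i => ⟪w', b i⟫) *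
      Matrix.replicateRow Unit (fun i => ⟪w', b i⟫) := by
    ext i j
    have hιe' : ∀ z, ⟪ι z, e⟫ = 0 := fun z => by rw [real_inner_comm, hιe]
    have h3 := orthonormal_iff_ite.1 b.orthonormal i j
    simp [hL, inner_add_left, inner_add_right, real_inner_smul_left, real_inner_smul_right,
      he, hιe, hιe', h3, Matrix.mul_apply, Matrix.one_apply, mul_comm]
  rw [h2, Matrix.det_one_add_replicateCol_mul_replicateRow]
  congr 1
  have h3 := b.sum_sq_norm_inner_right w'
  rw [← h3, dotProduct]
  refine Finset.sum_congr rfl fun i _ => ?_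
  rw [Real.norm_eq_abs, sq_abs, real_inner_comm, sq]

end NormDet

/-! ### Surface measure and volume in graph coordinates. -/

section Graph

variable {N : ℕ} {e : EuclideanSpace ℝ (Fin N)} {γ : EuclideanSpace ℝ (Fin N) → ℝ}

lemma hasFDerivAt_gradient (hγ : ContDiff ℝ 1 γ) (x : EuclideanSpace ℝ (Fin N)) :
    HasFDerivAt γ (innerSL ℝ (gradient γ x)) x := by
  have h := (hγ.differentiable one_ne_zero x).hasGradientAt.hasFDerivAt
  exact h

lemma inner_gradient_eq_zero (hγ : ContDiff ℝ 1 γ)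
    (hinv : ∀ (y : EuclideanSpace ℝ (Fin N)) (t : ℝ), γ (y + t • e) = γ y)
    (x : EuclideanSpace ℝ (Fin N)) : ⟪gradient γ x, e⟫ = 0 := by
  have hl : HasDerivAt (fun t : ℝ => x + t • e) e 0 := by
    simpa using ((hasDerivAt_id (0 : ℝ)).smul_const e).const_add x
  have hx : HasFDerivAt γ (innerSL ℝ (gradient γ x)) (x + (0 : ℝ) • e) := by
    simpa using hasFDerivAt_gradient hγ x
  have h1 := hx.comp_hasDerivAt 0 hl
  have h2 : HasDerivAt (γ ∘ fun t : ℝ => x + t • e) 0 0 := by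
    have : (γ ∘ fun t : ℝ => x + t • e) = fun _ => γ x := by
      ext t; exact hinv x t
    rw [this]
    exact hasDerivAt_const _ _
  exact h1.unique h2

lemma gradient_add_smul
    (hinv : ∀ (y : EuclideanSpace ℝ (Fin N)) (t : ℝ), γ (y + t • e) = γ y)
    (x : EuclideanSpace ℝ (Fin N)) (t : ℝ) : gradient γ (x + t • e) = gradient γ x := by
  have h : fderiv ℝ (fun y => γ (y + t • e)) x = fderiv ℝ γ (x + t • e) :=
    fderiv_comp_add_right _
  simp only [hinv] at h
  rw [gradient, gradient, ← h]

lemma continuous_gradient (hγ : ContDiff ℝ 1 γ) : Continuous (gradient γ) :=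
  (InnerProductSpace.toDual ℝ _).symm.continuous.comp (hγ.continuous_fderiv one_ne_zero)

/-- The parametrization `y ↦ y + γ(y) e` of the graph of `γ` by the hyperplane orthogonal to `e`. -/
noncomputable def graphMap (e : EuclideanSpace ℝ (Fin N)) (γ : EuclideanSpace ℝ (Fin N) → ℝ)
    (y : (ℝ ∙ e)ᗮ) : EuclideanSpace ℝ (Fin N) :=
  y + γ y • e

/-- The coordinates `(y, s) ↦ y + (γ(y) + s) e` adapted to the graph of `γ`. -/
noncomputable def graphCoord (e : EuclideanSpace ℝ (Fin N)) (γ : EuclideanSpace ℝ (Fin N) → ℝ)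
    (p : (ℝ ∙ e)ᗮ × ℝ) : EuclideanSpace ℝ (Fin N) :=
  p.1 + (γ p.1 + p.2) • e

lemma graphCoord_zero (y : (ℝ ∙ e)ᗮ) : graphCoord e γ (y, 0) = graphMap e γ y := by
  simp [graphCoord, graphMap]

lemma inner_orthogonal (y : (ℝ ∙ e)ᗮ) : ⟪e, (y : EuclideanSpace ℝ (Fin N))⟫ = 0 :=
  Submodule.mem_orthogonal_singleton_iff_inner_right.1 y.2

lemma inner_graphCoord (he : ‖e‖ = 1) (p : (ℝ ∙ e)ᗮ × ℝ) :
    ⟪e, graphCoord e γ p⟫ = γ p.1 + p.2 := by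
  rw [graphCoord, inner_add_right, inner_orthogonal, real_inner_smul_right,
    real_inner_self_eq_norm_sq, he]
  ring

lemma apply_graphCoord
    (hinv : ∀ (y : EuclideanSpace ℝ (Fin N)) (t : ℝ), γ (y + t • e) = γ y)
    (p : (ℝ ∙ e)ᗮ × ℝ) : γ (graphCoord e γ p) = γ p.1 := hinv _ _

lemma continuous_graphCoord (hγ : Continuous γ) : Continuous (graphCoord e γ) := by
  unfold graphCoord
  fun_prop

lemma continuous_graphMap (hγ : Continuous γ) : Continuous (graphMap e γ) := by
  unfold graphMap
  fun_prop

lemma finrank_orthogonal (he : ‖e‖ = 1) : finrank ℝ (ℝ ∙ e)ᗮ = N - 1 := by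
  have hne : e ≠ 0 := by
    rintro rfl
    simp at he
  have h1 := (ℝ ∙ e).finrank_add_finrank_orthogonal
  rw [finrank_span_singleton hne, finrank_euclideanSpace, Fintype.card_fin] at h1
  omega

lemma range_graphMap (he : ‖e‖ = 1)
    (hinv : ∀ (y : EuclideanSpace ℝ (Fin N)) (t : ℝ), γ (y + t • e) = γ y) :
    range (graphMap e γ) = {x | γ x = ⟪e, x⟫} := by
  ext x
  constructor
  · rintro ⟨y, rfl⟩
    rw [← graphCoord_zero, mem_ofPred_eq, inner_graphCoord he, apply_graphCoord hinv, add_zero]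
  · intro hx
    have hmem : x - ⟪e, x⟫ • e ∈ (ℝ ∙ e)ᗮ := by
      rw [Submodule.mem_orthogonal_singleton_iff_inner_right, inner_sub_right,
        real_inner_smul_right, real_inner_self_eq_norm_sq, he]
      ring
    refine ⟨⟨_, hmem⟩, ?_⟩
    have h1 : γ (x - ⟪e, x⟫ • e) = γ x := by
      rw [sub_eq_add_neg, ← neg_smul, hinv]
    rw [mem_ofPred_eq] at hx
    simp only [graphMap]
    rw [h1, hx, sub_add_cancel]

/-- By Pythagoras, since orthogonal projection is a left inverse of the parametrization. This is the
expansion that the area formula asks for. -/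
lemma norm_sub_le_norm_graphMap_sub (he : ‖e‖ = 1) (x y : (ℝ ∙ e)ᗮ) :
    ‖x - y‖ ≤ ‖graphMap e γ x - graphMap e γ y‖ := by
  have h1 : graphMap e γ x - graphMap e γ y =
      ((x - y : (ℝ ∙ e)ᗮ) : EuclideanSpace ℝ (Fin N)) + (γ x - γ y) • e := by
    simp only [graphMap, Submodule.coe_sub, sub_smul]
    abel
  rw [h1, ← sq_le_sq₀ (norm_nonneg _) (norm_nonneg _), norm_add_sq_real, real_inner_smul_right,
    real_inner_comm, inner_orthogonal, norm_smul, he, Submodule.coe_norm]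
  nlinarith [sq_nonneg ‖γ x - γ y‖]

lemma measurableEmbedding_graphMap (he : ‖e‖ = 1) (hγ : Continuous γ) :
    MeasurableEmbedding (graphMap e γ) := by
  have hanti : AntilipschitzWith 1 (graphMap e γ) :=
    AntilipschitzWith.of_le_mul_dist fun x y => by
      simpa [dist_eq_norm] using norm_sub_le_norm_graphMap_sub (γ := γ) he x y
  exact (continuous_graphMap hγ).measurableEmbedding hanti.injective

/-- The area formula for a `C¹` graph. -/
theorem comap_graphMap (he : ‖e‖ = 1) (hγ : ContDiff ℝ 1 γ)
    (hinv : ∀ (y : EuclideanSpace ℝ (Fin N)) (t : ℝ), γ (y + t • e) = γ y) :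
    (μHE[N - 1]).comap (graphMap e γ) = volume.withDensity
      fun y : (ℝ ∙ e)ᗮ => ENNReal.ofReal ‖gradient γ (graphMap e γ y) - e‖ := by
  have hgrad : ∀ y : (ℝ ∙ e)ᗮ, gradient γ (graphMap e γ y) = gradient γ y :=
    fun y => gradient_add_smul hinv _ _
  have horth : ∀ x, ⟪gradient γ x, e⟫ = 0 := inner_gradient_eq_zero hγ hinv
  set Φ' : (ℝ ∙ e)ᗮ → (ℝ ∙ e)ᗮ →L[ℝ] EuclideanSpace ℝ (Fin N) := fun y =>
    (ℝ ∙ e)ᗮ.subtypeL + ((innerSL ℝ (gradient γ y)).comp (ℝ ∙ e)ᗮ.subtypeL).smulRight e with hΦ'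
  have hΦ'app : ∀ y z, Φ' y z = (z : EuclideanSpace ℝ (Fin N)) +
      ⟪gradient γ y, (z : EuclideanSpace ℝ (Fin N))⟫ • e := fun y z => rfl
  rw [← finrank_orthogonal he]
  refine comap_euclideanHausdorffMeasure_eq_withDensity (Φ' := Φ') ?_
    (norm_sub_le_norm_graphMap_sub he) ?_ ?_ ?_ ?_ (measurableEmbedding_graphMap he hγ.continuous)
  · intro y
    have h1 : HasStrictFDerivAt γ (innerSL ℝ (gradient γ y)) (y : EuclideanSpace ℝ (Fin N)) :=
      hγ.contDiffAt.hasStrictFDerivAt' (hasFDerivAt_gradient hγ _) one_ne_zero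
    have h2 := ((ℝ ∙ e)ᗮ.subtypeL.hasStrictFDerivAt (x := y))
    exact h2.add ((h1.comp y h2).smul_const e)
  · intro y z
    rw [hΦ'app, ← sq_le_sq₀ (norm_nonneg _) (norm_nonneg _), norm_add_sq_real,
      real_inner_smul_right, real_inner_comm e _, inner_orthogonal, Submodule.coe_norm]
    nlinarith [sq_nonneg ‖⟪gradient γ y, (z : EuclideanSpace ℝ (Fin N))⟫ • e‖]
  · intro y
    rw [hgrad]
    symm
    refine normDet_graph (ℝ ∙ e)ᗮ.subtypeₗᵢ _ he (fun z => inner_orthogonal z) ?_ (fun z => rfl)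
    refine ⟨⟨gradient γ y, ?_⟩, rfl⟩
    rw [Submodule.mem_orthogonal_singleton_iff_inner_left]
    exact horth _
  · exact (((continuous_gradient hγ).comp (continuous_graphMap hγ.continuous)).sub
      continuous_const).norm
  · intro y
    rw [norm_pos_iff, sub_ne_zero]
    intro h
    have := horth (graphMap e γ y)
    rw [h, real_inner_self_eq_norm_sq, he] at this
    norm_num at this

/-- The surface element √(1 + |∇γ|²) is kept as ‖∇γ − e‖, the factor by which the normal is
normalized, so that the two cancel in the flux. -/
theorem setIntegral_graph (he : ‖e‖ = 1) (hγ : ContDiff ℝ 1 γ)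
    (hinv : ∀ (y : EuclideanSpace ℝ (Fin N)) (t : ℝ), γ (y + t • e) = γ y)
    (k : EuclideanSpace ℝ (Fin N) → ℝ) :
    ∫ x in {x | γ x = ⟪e, x⟫}, k x ∂μHE[N - 1] =
      ∫ y : (ℝ ∙ e)ᗮ, ‖gradient γ (graphMap e γ y) - e‖ * k (graphMap e γ y) := by
  have hemb := measurableEmbedding_graphMap (e := e) he hγ.continuous
  rw [← range_graphMap he hinv, ← hemb.map_comap, hemb.integral_map, comap_graphMap he hγ hinv]
  have hm : Measurable fun y : (ℝ ∙ e)ᗮ =>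
      (‖gradient γ (graphMap e γ y) - e‖).toNNReal :=
    ((((continuous_gradient hγ).comp (continuous_graphMap hγ.continuous)).sub
      continuous_const).norm).measurable.real_toNNReal
  refine (integral_withDensity_eq_integral_smul hm _).trans ?_
  refine integral_congr_ae (Eventually.of_forall fun y => ?_)
  simp [NNReal.smul_def]

theorem measure_graph_inter_lt_top (he : ‖e‖ = 1) (hγ : ContDiff ℝ 1 γ)
    (hinv : ∀ (y : EuclideanSpace ℝ (Fin N)) (t : ℝ), γ (y + t • e) = γ y)
    {B : Set (EuclideanSpace ℝ (Fin N))} (hB : Bornology.IsBounded B) (hBm : MeasurableSet B) :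
    μHE[N - 1] (B ∩ {x | γ x = ⟪e, x⟫}) < ⊤ := by
  have hemb := measurableEmbedding_graphMap (e := e) he hγ.continuous
  have hJ : Continuous fun y : (ℝ ∙ e)ᗮ => ‖gradient γ (graphMap e γ y) - e‖ :=
    (((continuous_gradient hγ).comp (continuous_graphMap hγ.continuous)).sub
      continuous_const).norm
  set A := graphMap e γ ⁻¹' B
  have hA : Bornology.IsBounded A := by
    obtain ⟨C, hC⟩ := Metric.isBounded_iff.1 hB
    refine Metric.isBounded_iff.2 ⟨C, fun x hx y hy => le_trans ?_ (hC hx hy)⟩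
    simpa [dist_eq_norm] using norm_sub_le_norm_graphMap_sub (γ := γ) he x y
  have h1 : B ∩ {x | γ x = ⟪e, x⟫} = graphMap e γ '' A := by
    rw [image_preimage_eq_inter_range, range_graphMap he hinv]
  rw [h1, ← hemb.comap_apply, comap_graphMap he hγ hinv,
    withDensity_apply _ (hemb.measurable hBm)]
  have hint : IntegrableOn (fun y : (ℝ ∙ e)ᗮ => ‖gradient γ (graphMap e γ y) - e‖) A :=
    (hJ.continuousOn.integrableOn_compact hA.isCompact_closure).mono_set subset_closure
  have := hint.lintegral_lt_top
  exact this

/-- A shear (y, s) ↦ (y, γ(y) + s) followed by the orthogonal splitting of the space into the line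
of e and its complement. Continuity of γ is enough. -/
theorem measurePreserving_graphCoord (he : ‖e‖ = 1) (hγ : Continuous γ) :
    MeasurePreserving (graphCoord e γ) := by
  have h1 : MeasurePreserving (fun p : (ℝ ∙ e)ᗮ × ℝ => (p.1, γ p.1 + p.2))
      (volume.prod volume) (volume.prod volume) :=
    (MeasurePreserving.id (volume : Measure (ℝ ∙ e)ᗮ)).skew_product
      (g := fun (y : (ℝ ∙ e)ᗮ) (s : ℝ) => γ y + s)
      (by unfold Function.uncurry; fun_prop)
      (Eventually.of_forall fun y => (measurePreserving_add_left volume (γ y)).map_eq)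
  have h2 : MeasurePreserving (fun p : (ℝ ∙ e)ᗮ × ℝ =>
      (LinearIsometryEquiv.toSpanUnitSingleton e he p.2, p.1))
      (volume.prod volume) (volume.prod volume) :=
    ((LinearIsometryEquiv.measurePreserving _).prod (MeasurePreserving.id _)).comp
      Measure.measurePreserving_swap
  have h3 := ((ℝ ∙ e).measurePreserving_measurableEquivProd (0 : EuclideanSpace ℝ (Fin N))).symm
  rw [InnerProductSpace.euclideanHausdorffMeasure_eq_volume] at h3
  have h4 := h3.comp (h2.comp h1)
  convert h4 using 1
  · ext1 p
    simp [graphCoord, add_comm]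
  · rfl

end Graph

/-! ### A one-dimensional cutoff. -/

section Cutoff

/-- A smooth function that vanishes for `t ≤ 1` and equals `1` for `t ≥ 2`. -/
noncomputable def cutoff (t : ℝ) : ℝ := Real.smoothTransition (t - 1)

lemma contDiff_cutoff : ContDiff ℝ 1 cutoff := by
  unfold cutoff
  exact (Real.smoothTransition.contDiff (n := 1)).comp (contDiff_id.sub contDiff_const)

lemma cutoff_of_le {t : ℝ} (h : t ≤ 1) : cutoff t = 0 :=
  Real.smoothTransition.zero_of_nonpos (by linarith)

lemma cutoff_of_ge {t : ℝ} (h : 2 ≤ t) : cutoff t = 1 :=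
  Real.smoothTransition.one_of_one_le (by linarith)

lemma abs_cutoff_le (t : ℝ) : |cutoff t| ≤ 1 := by
  rw [cutoff, abs_of_nonneg (Real.smoothTransition.nonneg _)]
  exact Real.smoothTransition.le_one _

lemma deriv_cutoff_of_lt {t : ℝ} (h : t < 1) : deriv cutoff t = 0 := by
  have : cutoff =ᶠ[𝓝 t] fun _ => 0 :=
    (eventually_lt_nhds h).mono fun s hs => cutoff_of_le hs.le
  rw [this.deriv_eq, deriv_const]

lemma deriv_cutoff_of_gt {t : ℝ} (h : 2 < t) : deriv cutoff t = 0 := by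
  have : cutoff =ᶠ[𝓝 t] fun _ => 1 :=
    (eventually_gt_nhds h).mono fun s hs => cutoff_of_ge (le_of_lt hs)
  rw [this.deriv_eq, deriv_const]

lemma continuous_deriv_cutoff : Continuous (deriv cutoff) :=
  contDiff_cutoff.continuous_deriv le_rfl

/-- This unit mass makes ε⁻¹ψ'(h/ε), where ψ is `cutoff`, an approximate surface density as ε → 0.
-/
lemma integral_deriv_cutoff : ∫ t, deriv cutoff t = 1 := by
  have hs : Function.support (deriv cutoff) ⊆ Ioc 0 3 := by
    intro t ht
    by_contra hn
    refine ht ?_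
    rcases not_and_or.1 hn with h | h
    · exact deriv_cutoff_of_lt (by linarith)
    · exact deriv_cutoff_of_gt (by linarith)
  rw [← intervalIntegral.integral_eq_integral_of_support_subset hs,
    intervalIntegral.integral_deriv_eq_sub
      (fun x _ => contDiff_cutoff.differentiable one_ne_zero x)
      (continuous_deriv_cutoff.intervalIntegrable _ _),
    cutoff_of_ge (by norm_num), cutoff_of_le (by norm_num), sub_zero]

lemma hasCompactSupport_deriv_cutoff : HasCompactSupport (deriv cutoff) := by
  refine HasCompactSupport.intro (isCompact_Icc (a := (1 : ℝ)) (b := 2)) fun t ht => ?_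
  rcases not_and_or.1 ht with h | h
  · exact deriv_cutoff_of_lt (not_le.1 h)
  · exact deriv_cutoff_of_gt (not_le.1 h)

end Cutoff

/-! ### Divergence of compactly supported fields on the whole space. -/

section Divergence

variable {N : ℕ}

/-- The divergence of a vector field. -/
noncomputable def divergence (Q : EuclideanSpace ℝ (Fin N) → EuclideanSpace ℝ (Fin N))
    (x : EuclideanSpace ℝ (Fin N)) : ℝ :=
  LinearMap.trace ℝ (EuclideanSpace ℝ (Fin N)) (fderiv ℝ Q x).toLinearMap

lemma divergence_smul {φ : EuclideanSpace ℝ (Fin N) → ℝ}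
    {Q : EuclideanSpace ℝ (Fin N) → EuclideanSpace ℝ (Fin N)} {x : EuclideanSpace ℝ (Fin N)}
    (hφ : DifferentiableAt ℝ φ x) (hQ : DifferentiableAt ℝ Q x) :
    divergence (fun y => φ y • Q y) x = φ x * divergence Q x + fderiv ℝ φ x (Q x) := by
  rw [divergence, fderiv_fun_smul hφ hQ]
  have : ((φ x • fderiv ℝ Q x + (fderiv ℝ φ x).smulRight (Q x) :
      EuclideanSpace ℝ (Fin N) →L[ℝ] EuclideanSpace ℝ (Fin N)) :
      EuclideanSpace ℝ (Fin N) →ₗ[ℝ] EuclideanSpace ℝ (Fin N)) =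
      φ x • (fderiv ℝ Q x).toLinearMap + (fderiv ℝ φ x).toLinearMap.smulRight (Q x) := rfl
  rw [this, map_add, map_smul, LinearMap.trace_smulRight, divergence]
  rfl

lemma divergence_congr {Q R : EuclideanSpace ℝ (Fin N) → EuclideanSpace ℝ (Fin N)}
    {x : EuclideanSpace ℝ (Fin N)} (h : Q =ᶠ[𝓝 x] R) : divergence Q x = divergence R x := by
  rw [divergence, divergence, h.fderiv_eq]

lemma divergence_zero (x : EuclideanSpace ℝ (Fin N)) :
    divergence (fun _ => (0 : EuclideanSpace ℝ (Fin N))) x = 0 := by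
  simp [divergence]

/-- Integration by parts against the constant function 1. -/
lemma integral_fderiv_apply_eq_zero {w : EuclideanSpace ℝ (Fin N) → ℝ} (hw : ContDiff ℝ 1 w)
    (hc : HasCompactSupport w) (v : EuclideanSpace ℝ (Fin N)) : ∫ x, fderiv ℝ w x v = 0 := by
  have hi : Integrable fun x => fderiv ℝ w x v :=
    ((hw.continuous_fderiv one_ne_zero).clm_apply continuous_const).integrable_of_hasCompactSupport
      (hc.fderiv_apply (𝕜 := ℝ) v)
  have h := integral_mul_fderiv_eq_neg_fderiv_mul_of_integrable (μ := volume)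
    (f := fun _ : EuclideanSpace ℝ (Fin N) => (1 : ℝ)) (g := w) (v := v) (by simp)
    (by simpa using hi) (by simpa using hw.continuous.integrable_of_hasCompactSupport hc)
    (fun _ _ => differentiableAt_const _) (fun x _ => hw.differentiable one_ne_zero x)
  simpa using h

lemma integral_divergence_eq_zero
    {Q : EuclideanSpace ℝ (Fin N) → EuclideanSpace ℝ (Fin N)} (hQ : ContDiff ℝ 1 Q)
    (hc : HasCompactSupport Q) : ∫ x, divergence Q x = 0 := by
  set b := EuclideanSpace.basisFun (Fin N) ℝ
  have h1 : ∀ x, divergence Q x = ∑ i, fderiv ℝ (fun y => ⟪b i, Q y⟫) x (b i) := by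
    intro x
    rw [divergence, LinearMap.trace_eq_sum_inner _ b]
    refine Finset.sum_congr rfl fun i _ => ?_
    have h2 := ((innerSL ℝ (b i)).hasFDerivAt (x := Q x)).comp x
      (hQ.differentiable one_ne_zero x).hasFDerivAt
    have h3 : fderiv ℝ (fun y => ⟪b i, Q y⟫) x = _ := h2.fderiv
    rw [h3]
    rfl
  have hC : ∀ i, ContDiff ℝ 1 fun y => ⟪b i, Q y⟫ := fun i => contDiff_const.inner ℝ hQ
  have hS : ∀ i, HasCompactSupport fun y => ⟪b i, Q y⟫ := fun i =>
    hc.mono fun x hx => by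
      contrapose! hx
      simp only [Function.mem_support, not_not] at hx ⊢
      rw [hx, inner_zero_right]
  simp only [h1]
  rw [integral_finsetSum]
  · exact Finset.sum_eq_zero fun i _ => integral_fderiv_apply_eq_zero (hC i) (hS i) _
  · exact fun i _ => (((hC i).continuous_fderiv one_ne_zero).clm_apply
      continuous_const).integrable_of_hasCompactSupport ((hS i).fderiv_apply (𝕜 := ℝ) _)

end Divergence

/-! ### Concentration of the cutoff gradient on the graph. -/

section GraphNeighborhood

variable {N : ℕ} {Ω : Set (EuclideanSpace ℝ (Fin N))} {e : EuclideanSpace ℝ (Fin N)}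
  {γ : EuclideanSpace ℝ (Fin N) → ℝ} {W : Set (EuclideanSpace ℝ (Fin N))}

/-- A small push in the direction e leaves γ unchanged and raises the height, so it enters Ω. -/
lemma mem_closure_of_graph_le (he : ‖e‖ = 1)
    (hinv : ∀ (y : EuclideanSpace ℝ (Fin N)) (t : ℝ), γ (y + t • e) = γ y)
    (hW : IsOpen W) (hmem : ∀ y ∈ W, y ∈ Ω ↔ γ y < ⟪e, y⟫)
    {y : EuclideanSpace ℝ (Fin N)} (hy : y ∈ W) (hle : γ y ≤ ⟪e, y⟫) : y ∈ closure Ω := by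
  have hl : Tendsto (fun t : ℝ => y + t • e) (𝓝[>] 0) (𝓝 y) := by
    have h1 : Continuous fun t : ℝ => y + t • e := by fun_prop
    have h2 := h1.tendsto 0
    simp only [zero_smul, add_zero] at h2
    exact h2.mono_left nhdsWithin_le_nhds
  refine mem_closure_of_tendsto hl ?_
  filter_upwards [hl.eventually (hW.mem_nhds hy), self_mem_nhdsWithin] with t ht ht0
  have ht0 : (0 : ℝ) < t := ht0
  rw [hmem _ ht, hinv, inner_add_right, real_inner_smul_right, real_inner_self_eq_norm_sq, he]
  linarith

lemma mem_frontier_iff_graph (he : ‖e‖ = 1) (hγ : Continuous γ)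
    (hinv : ∀ (y : EuclideanSpace ℝ (Fin N)) (t : ℝ), γ (y + t • e) = γ y) (hΩ : IsOpen Ω)
    (hW : IsOpen W) (hmem : ∀ y ∈ W, y ∈ Ω ↔ γ y < ⟪e, y⟫)
    {y : EuclideanSpace ℝ (Fin N)} (hy : y ∈ W) : y ∈ frontier Ω ↔ γ y = ⟪e, y⟫ := by
  rw [hΩ.frontier_eq, Set.mem_sdiff, hmem y hy, not_lt]
  constructor
  · rintro ⟨h1, h2⟩
    refine le_antisymm ?_ h2
    by_contra hlt
    have h3 : ∀ᶠ z in 𝓝 y, ⟪e, z⟫ < γ z :=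
      ContinuousAt.eventually_lt (by fun_prop) hγ.continuousAt (not_le.1 hlt)
    obtain ⟨z, hz, hz1, hz2⟩ := ((mem_closure_iff_frequently.1 h1).and_eventually
      (h3.and (hW.mem_nhds hy))).exists
    exact absurd ((hmem z hz2).1 hz) hz1.not_gt
  · intro h
    exact ⟨mem_closure_of_graph_le he hinv hW hmem hy h.le, h.ge⟩

lemma injective_graphCoord (he : ‖e‖ = 1)
    (hinv : ∀ (y : EuclideanSpace ℝ (Fin N)) (t : ℝ), γ (y + t • e) = γ y) :
    Function.Injective (graphCoord e γ) := by
  rintro p p' h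
  have h1 := apply_graphCoord hinv p
  have h2 := inner_graphCoord (γ := γ) he p
  rw [h, apply_graphCoord hinv p'] at h1
  rw [h, inner_graphCoord he p'] at h2
  have h3 : p.2 = p'.2 := by linarith
  have h4 := h
  simp only [graphCoord, h1, h3, add_left_inj] at h4
  exact Prod.ext (Subtype.ext h4) h3

lemma norm_le_norm_graphCoord (p : (ℝ ∙ e)ᗮ × ℝ) : ‖p.1‖ ≤ ‖graphCoord e γ p‖ := by
  rw [graphCoord, ← sq_le_sq₀ (norm_nonneg _) (norm_nonneg _), norm_add_sq_real,
    real_inner_smul_right, real_inner_comm e _, inner_orthogonal, Submodule.coe_norm]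
  nlinarith [sq_nonneg ‖(γ p.1 + p.2) • e‖]

/-- The flux density, in graph coordinates, extended constantly below the graph. -/
lemma continuous_comp_graphCoord_max (he : ‖e‖ = 1) (hγ : Continuous γ)
    (hinv : ∀ (y : EuclideanSpace ℝ (Fin N)) (t : ℝ), γ (y + t • e) = γ y)
    (hW : IsOpen W) (hmem : ∀ y ∈ W, y ∈ Ω ↔ γ y < ⟪e, y⟫) {q : EuclideanSpace ℝ (Fin N) → ℝ}
    (hq : ContinuousOn q (closure Ω)) (hqW : tsupport q ⊆ W) :
    Continuous fun p : (ℝ ∙ e)ᗮ × ℝ => q (graphCoord e γ (p.1, max p.2 0)) := by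
  have hΨ : Continuous fun p : (ℝ ∙ e)ᗮ × ℝ => graphCoord e γ (p.1, max p.2 0) :=
    (continuous_graphCoord hγ).comp (by fun_prop)
  have hcl : ∀ p : (ℝ ∙ e)ᗮ × ℝ, graphCoord e γ (p.1, max p.2 0) ∈ W →
      graphCoord e γ (p.1, max p.2 0) ∈ closure Ω := by
    intro p hp
    refine mem_closure_of_graph_le he hinv hW hmem hp ?_
    rw [inner_graphCoord he, apply_graphCoord hinv]
    simp
  refine continuous_iff_continuousAt.2 fun p => ?_
  -- On the support of q the point lies in W, so nearby points of the truncated coordinates stay in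
  -- `closure Ω`, where q is continuous. Off the support q vanishes nearby.
  by_cases hp : graphCoord e γ (p.1, max p.2 0) ∈ tsupport q
  · have h1 := hΨ.continuousAt.eventually (hW.mem_nhds (hqW hp))
    have h2 : Tendsto (fun p : (ℝ ∙ e)ᗮ × ℝ => graphCoord e γ (p.1, max p.2 0)) (𝓝 p)
        (𝓝[closure Ω] (graphCoord e γ (p.1, max p.2 0))) :=
      tendsto_nhdsWithin_iff.2 ⟨hΨ.continuousAt, h1.mono fun r hr => hcl r hr⟩
    exact (hq _ (hcl p (hqW hp))).tendsto.comp h2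
  · have h1 : q =ᶠ[𝓝 (graphCoord e γ (p.1, max p.2 0))] 0 :=
      notMem_tsupport_iff_eventuallyEq.1 hp
    have h2 : (fun p : (ℝ ∙ e)ᗮ × ℝ => q (graphCoord e γ (p.1, max p.2 0))) =ᶠ[𝓝 p]
        fun _ => 0 := hΨ.continuousAt.eventually h1
    exact continuousAt_const.congr h2.symm

/-- Concentration of `ε⁻¹ ψ'(h / ε) q`, where `h` is the height above the graph of `γ`. -/
lemma tendsto_integral_deriv_cutoff (he : ‖e‖ = 1) (hγ : Continuous γ)
    (hinv : ∀ (y : EuclideanSpace ℝ (Fin N)) (t : ℝ), γ (y + t • e) = γ y)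
    (hW : IsOpen W) (hmem : ∀ y ∈ W, y ∈ Ω ↔ γ y < ⟪e, y⟫) {q : EuclideanSpace ℝ (Fin N) → ℝ}
    (hq : ContinuousOn q (closure Ω)) (hqW : tsupport q ⊆ W) (hqc : HasCompactSupport q) :
    Tendsto (fun ε : ℝ => ∫ x, ε⁻¹ * deriv cutoff ((⟪e, x⟫ - γ x) / ε) * q x) (𝓝[>] 0)
      (𝓝 (∫ y : (ℝ ∙ e)ᗮ, q (graphMap e γ y))) := by
  -- Only the side s ≥ 0 of the graph matters, since ψ'(s/ε) vanishes for s < 0; the truncation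
  -- replaces q by a function continuous everywhere.
  set k : (ℝ ∙ e)ᗮ × ℝ → ℝ := fun p => q (graphCoord e γ (p.1, max p.2 0)) with hk
  have hkc : Continuous k := continuous_comp_graphCoord_max he hγ hinv hW hmem hq hqW
  obtain ⟨R, hR⟩ := hqc.isCompact.isBounded.exists_norm_le
  set B : Set (ℝ ∙ e)ᗮ := Metric.closedBall 0 R
  have hB : IsCompact B := isCompact_closedBall _ _
  have hkB : ∀ p : (ℝ ∙ e)ᗮ × ℝ, p.1 ∉ B → k p = 0 := by
    intro p hp
    by_contra h
    refine hp ?_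
    rw [mem_closedBall_zero_iff]
    exact (norm_le_norm_graphCoord (γ := γ) (p.1, max p.2 0)).trans
      (hR _ (subset_tsupport _ h))
  have hIF : ∀ c : ℝ, Integrable fun p : (ℝ ∙ e)ᗮ × ℝ => deriv cutoff p.2 * k (p.1, c * p.2) := by
    intro c
    refine Continuous.integrable_of_hasCompactSupport ?_ ?_
    · exact (continuous_deriv_cutoff.comp continuous_snd).mul (hkc.comp (by fun_prop))
    · refine HasCompactSupport.intro (hB.prod (isCompact_Icc (a := (1 : ℝ)) (b := 2)))
        fun p hp => ?_
      rcases not_and_or.1 hp with h | h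
      · rw [hkB (p.1, c * p.2) h, mul_zero]
      · rcases not_and_or.1 h with h | h
        · rw [deriv_cutoff_of_lt (not_le.1 h), zero_mul]
        · rw [deriv_cutoff_of_gt (not_le.1 h), zero_mul]
  -- Pass to graph coordinates and rescale the height by ε, which absorbs the factor ε⁻¹.
  have hscale : ∀ ε : ℝ, 0 < ε →
      ∫ x, ε⁻¹ * deriv cutoff ((⟪e, x⟫ - γ x) / ε) * q x =
      ∫ p : (ℝ ∙ e)ᗮ × ℝ, deriv cutoff p.2 * k (p.1, ε * p.2) := by
    intro ε hε
    have hemb : MeasurableEmbedding (graphCoord e γ) :=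
      (continuous_graphCoord hγ).measurableEmbedding (injective_graphCoord he hinv)
    rw [← (measurePreserving_graphCoord he hγ).integral_comp hemb]
    have h1 : ∀ p : (ℝ ∙ e)ᗮ × ℝ, ε⁻¹ * deriv cutoff ((⟪e, graphCoord e γ p⟫ -
        γ (graphCoord e γ p)) / ε) * q (graphCoord e γ p) =
        ε⁻¹ * (deriv cutoff (p.2 / ε) * k p) := by
      intro p
      rw [inner_graphCoord he, apply_graphCoord hinv, add_sub_cancel_left, mul_assoc]
      congr 1
      rcases le_or_gt 0 p.2 with h | h
      · simp only [hk, max_eq_left h]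
      · rw [deriv_cutoff_of_lt, zero_mul, zero_mul]
        exact (div_neg_of_neg_of_pos h hε).trans one_pos
    simp only [h1]
    have hIG : Integrable fun p : (ℝ ∙ e)ᗮ × ℝ => ε⁻¹ * (deriv cutoff (p.2 / ε) * k p) := by
      refine Integrable.const_mul (Continuous.integrable_of_hasCompactSupport ?_ ?_) _
      · exact (continuous_deriv_cutoff.comp (by fun_prop)).mul hkc
      · refine HasCompactSupport.intro (hB.prod (isCompact_Icc (a := ε) (b := 2 * ε)))
          fun p hp => ?_
        rcases not_and_or.1 hp with h | h
        · rw [hkB _ h, mul_zero]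
        · rcases not_and_or.1 h with h | h
          · rw [deriv_cutoff_of_lt, zero_mul]
            rw [div_lt_one hε]
            exact not_le.1 h
          · rw [deriv_cutoff_of_gt, zero_mul]
            rw [lt_div_iff₀ hε]
            exact not_le.1 h
    rw [Measure.volume_eq_prod] at hIG ⊢
    rw [integral_prod _ hIG, integral_prod _ (by simpa [Measure.volume_eq_prod] using hIF ε)]
    congr 1
    ext y
    have h2 := Measure.integral_comp_mul_left
      (fun s : ℝ => ε⁻¹ * (deriv cutoff (s / ε) * k (y, s))) ε
    rw [abs_of_pos (inv_pos.2 hε), smul_eq_mul, ← integral_const_mul] at h2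
    have h3 : ∀ s : ℝ, ε * s / ε = s := fun s => by field_simp
    simp only [h3, integral_const_mul] at h2 ⊢
    have h4 : ε⁻¹ ≠ 0 := (inv_pos.2 hε).ne'
    exact (mul_left_cancel₀ h4 h2).symm
  have hlim : ∫ y : (ℝ ∙ e)ᗮ, q (graphMap e γ y) =
      ∫ p : (ℝ ∙ e)ᗮ × ℝ, deriv cutoff p.2 * k (p.1, 0) := by
    have h1 := integral_prod_mul (μ := (volume : Measure (ℝ ∙ e)ᗮ)) (ν := (volume : Measure ℝ))
      (fun y => k (y, 0)) (deriv cutoff)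
    rw [integral_deriv_cutoff, mul_one] at h1
    simp only [hk, max_self, graphCoord_zero] at h1 ⊢
    rw [← h1, Measure.volume_eq_prod]
    simp only [mul_comm]
  rw [hlim]
  -- For 0 < ε < 1 and s ∈ [1, 2], the support of ψ', the height εs stays in [0, 2].
  have hbd : ∃ M, ∀ p ∈ B ×ˢ Icc (0 : ℝ) 2, ‖k p‖ ≤ M :=
    (hB.prod isCompact_Icc).exists_bound_of_continuousOn hkc.continuousOn
  obtain ⟨M, hM⟩ := hbd
  refine Tendsto.congr' (eventually_mem_nhdsWithin.mono fun ε hε => (hscale ε hε).symm) ?_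
  refine tendsto_integral_filter_of_dominated_convergence
    (fun p => B.indicator (fun _ => M) p.1 * ‖deriv cutoff p.2‖) ?_ ?_ ?_ ?_
  · exact Eventually.of_forall fun ε => (hIF ε).aestronglyMeasurable
  · have hsm : ∀ᶠ ε : ℝ in 𝓝[>] 0, 0 < ε ∧ ε < 1 :=
      eventually_mem_nhdsWithin.and (nhdsWithin_le_nhds (eventually_lt_nhds one_pos))
    filter_upwards [hsm] with ε hε
    refine Eventually.of_forall fun p => ?_
    rw [norm_mul, mul_comm]
    by_cases hp : p.1 ∈ B
    · rw [indicator_of_mem hp]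
      by_cases hs : p.2 ∈ Icc (1 : ℝ) 2
      · gcongr
        refine hM _ ⟨hp, ?_, ?_⟩
        · exact mul_nonneg hε.1.le (by linarith [hs.1])
        · change ε * p.2 ≤ 2
          nlinarith [hs.1, hs.2]
      · have : deriv cutoff p.2 = 0 := by
          rcases not_and_or.1 hs with h | h
          · exact deriv_cutoff_of_lt (not_le.1 h)
          · exact deriv_cutoff_of_gt (not_le.1 h)
        simp [this]
    · rw [indicator_of_notMem hp, hkB (p.1, ε * p.2) hp]
      simp
  · have h1 : Integrable (B.indicator fun _ => M) (volume : Measure (ℝ ∙ e)ᗮ) :=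
      (integrableOn_const hB.measure_lt_top.ne).integrable_indicator hB.measurableSet
    have h2 : Integrable (fun t => ‖deriv cutoff t‖) :=
      (continuous_deriv_cutoff.integrable_of_hasCompactSupport
        hasCompactSupport_deriv_cutoff).norm
    exact h1.mul_prod h2
  · refine Eventually.of_forall fun p => ?_
    have h1 : Continuous fun ε : ℝ => deriv cutoff p.2 * k (p.1, ε * p.2) :=
      continuous_const.mul (hkc.comp (by fun_prop))
    have h2 := h1.tendsto 0
    rw [zero_mul] at h2
    exact h2.mono_left nhdsWithin_le_nhds

end GraphNeighborhood

/-! ### The divergence theorem near one boundary point. -/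

section LocalDivergence

variable {N : ℕ} {Ω : Set (EuclideanSpace ℝ (Fin N))} {e : EuclideanSpace ℝ (Fin N)}
  {γ : EuclideanSpace ℝ (Fin N) → ℝ} {W : Set (EuclideanSpace ℝ (Fin N))}
  {φ D : EuclideanSpace ℝ (Fin N) → ℝ}
  {Q : EuclideanSpace ℝ (Fin N) → EuclideanSpace ℝ (Fin N)}

lemma fderiv_eq_zero_of_notMem_tsupport {x : EuclideanSpace ℝ (Fin N)} (hx : x ∉ tsupport φ) :
    fderiv ℝ φ x = 0 := by
  rw [(notMem_tsupport_iff_eventuallyEq.1 hx).fderiv_eq]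
  exact fderiv_const_apply _

lemma continuousOn_divergence_smul (hφ : ContDiff ℝ 1 φ)
    (hQc : ContinuousOn Q (closure Ω)) (hDc : ContinuousOn D (closure Ω)) :
    ContinuousOn (fun x => φ x * D x + fderiv ℝ φ x (Q x)) (closure Ω) :=
  (hφ.continuous.continuousOn.mul hDc).add
    ((hφ.continuous_fderiv one_ne_zero).continuousOn.clm_apply hQc)

lemma integrableOn_of_continuousOn_closure (hb : Bornology.IsBounded Ω)
    {a : EuclideanSpace ℝ (Fin N) → ℝ} (ha : ContinuousOn a (closure Ω)) : IntegrableOn a Ω :=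
  (ha.integrableOn_compact hb.isCompact_closure).mono_set subset_closure

/-- With χ = ψ(h/ε), the field χφQ vanishes near every point outside Ω, hence is C¹ with compact
support on the whole space and its divergence has integral zero. The product rule splits that
divergence into the two sides. Since ∇h = e − ∇γ, the sign change yields the outward direction ∇γ −
e. -/
lemma integral_eq_neg_of_cutoff (hΩ : IsOpen Ω) (hb : Bornology.IsBounded Ω)
    (hγ : ContDiff ℝ 1 γ) (hmem : ∀ y ∈ W, y ∈ Ω ↔ γ y < ⟪e, y⟫)
    (hφ : ContDiff ℝ 1 φ) (hφc : HasCompactSupport φ) (hφW : tsupport φ ⊆ W)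
    (hQ : ContDiffOn ℝ 1 Q Ω) (hQc : ContinuousOn Q (closure Ω))
    (hDc : ContinuousOn D (closure Ω)) (hD : ∀ x ∈ Ω, divergence Q x = D x)
    {ε : ℝ} (hε : 0 < ε) :
    ∫ x in Ω, cutoff ((⟪e, x⟫ - γ x) / ε) * (φ x * D x + fderiv ℝ φ x (Q x)) =
      ∫ x, ε⁻¹ * deriv cutoff ((⟪e, x⟫ - γ x) / ε) * (φ x * ⟪gradient γ x - e, Q x⟫) := by
  set χ : EuclideanSpace ℝ (Fin N) → ℝ := fun x => cutoff ((⟪e, x⟫ - γ x) / ε) with hχ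
  have hhc : Continuous fun x : EuclideanSpace ℝ (Fin N) => (⟪e, x⟫ - γ x) / ε := by
    have := hγ.continuous
    fun_prop
  have hχC : ContDiff ℝ 1 χ :=
    contDiff_cutoff.comp (((contDiff_const.inner ℝ contDiff_id).sub hγ).div_const ε)
  have hχ' : ∀ x, HasFDerivAt χ
      (deriv cutoff ((⟪e, x⟫ - γ x) / ε) • (ε⁻¹ • (innerSL ℝ e - innerSL ℝ (gradient γ x)))) x := by
    intro x
    have h1 : HasFDerivAt (fun x => (⟪e, x⟫ - γ x) / ε)
        (ε⁻¹ • (innerSL ℝ e - innerSL ℝ (gradient γ x))) x := by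
      simp only [div_eq_inv_mul]
      exact (((innerSL ℝ e).hasFDerivAt).sub (hasFDerivAt_gradient hγ x)).const_mul ε⁻¹
    exact (contDiff_cutoff.differentiable one_ne_zero _).hasDerivAt.comp_hasFDerivAt x h1
  have hout : ∀ x ∉ Ω, x ∉ tsupport φ ∨ (⟪e, x⟫ - γ x) / ε < 1 := by
    intro x hx
    by_cases h : x ∈ tsupport φ
    · right
      have h1 := (hmem x (hφW h)).not.1 hx
      have h2 : (⟪e, x⟫ - γ x) / ε ≤ 0 := div_nonpos_of_nonpos_of_nonneg (by linarith) hε.le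
      linarith
    · exact Or.inl h
  have hzero : ∀ x ∉ Ω, (fun y => (χ y * φ y) • Q y) =ᶠ[𝓝 x] fun _ => 0 := by
    intro x hx
    rcases hout x hx with h | h
    · filter_upwards [notMem_tsupport_iff_eventuallyEq.1 h] with y hy
      rw [hy, Pi.zero_apply, mul_zero, zero_smul]
    · filter_upwards [hhc.continuousAt.eventually_lt continuousAt_const h] with y hy
      rw [hχ]
      simp only
      rw [cutoff_of_le hy.le, zero_mul, zero_smul]
  have hR : ContDiff ℝ 1 fun y => (χ y * φ y) • Q y := by
    refine contDiff_iff_contDiffAt.2 fun x => ?_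
    by_cases hx : x ∈ Ω
    · exact (hχC.mul hφ).contDiffAt.smul (hQ.contDiffAt (hΩ.mem_nhds hx))
    · exact contDiffAt_const.congr_of_eventuallyEq (hzero x hx)
  have hRc : HasCompactSupport fun y => (χ y * φ y) • Q y :=
    (hφc.mul_left (f := χ)).smul_right
  have hdiv : ∀ x ∈ Ω, divergence (fun y => (χ y * φ y) • Q y) x =
      χ x * (φ x * D x + fderiv ℝ φ x (Q x)) -
        ε⁻¹ * deriv cutoff ((⟪e, x⟫ - γ x) / ε) * (φ x * ⟪gradient γ x - e, Q x⟫) := by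
    intro x hx
    have h1 : HasFDerivAt (fun y => χ y * φ y) _ x :=
      (hχ' x).mul (hφ.differentiable one_ne_zero x).hasFDerivAt
    rw [divergence_smul h1.differentiableAt
      ((hQ.contDiffAt (hΩ.mem_nhds hx)).differentiableAt one_ne_zero), hD x hx]
    rw [show fderiv ℝ (fun y => χ y * φ y) x = _ from h1.fderiv]
    simp only [add_apply, smul_apply, smul_eq_mul, sub_apply, innerSL_apply_apply, inner_sub_left]
    ring
  have hdiv0 : ∀ x ∉ Ω, divergence (fun y => (χ y * φ y) • Q y) x = 0 := fun x hx => by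
    rw [divergence_congr (hzero x hx), divergence_zero]
  have h0 := integral_divergence_eq_zero hR hRc
  rw [← setIntegral_eq_integral_of_forall_compl_eq_zero hdiv0,
    setIntegral_congr_fun hΩ.measurableSet hdiv, integral_sub, sub_eq_zero] at h0
  · rw [h0]
    refine setIntegral_eq_integral_of_forall_compl_eq_zero fun x hx => ?_
    rcases hout x hx with h | h
    · rw [image_eq_zero_of_notMem_tsupport h]
      ring
    · rw [deriv_cutoff_of_lt h]
      ring
  · exact integrableOn_of_continuousOn_closure hb
      (hχC.continuous.continuousOn.mul (continuousOn_divergence_smul hφ hQc hDc))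
  · refine integrableOn_of_continuousOn_closure hb ?_
    have h1 : Continuous fun x : EuclideanSpace ℝ (Fin N) =>
        ε⁻¹ * deriv cutoff ((⟪e, x⟫ - γ x) / ε) :=
      continuous_const.mul (continuous_deriv_cutoff.comp hhc)
    exact h1.continuousOn.mul (hφ.continuous.continuousOn.mul
      (((continuous_gradient hγ).sub continuous_const).continuousOn.inner hQc))

/-- Let ε → 0⁺ in `integral_eq_neg_of_cutoff`: on Ω ∩ `tsupport φ` the cutoff tends to 1, and the
other side concentrates on the graph. -/
lemma setIntegral_divergence_eq_integral_graph (hΩ : IsOpen Ω) (hb : Bornology.IsBounded Ω)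
    (he : ‖e‖ = 1) (hγ : ContDiff ℝ 1 γ)
    (hinv : ∀ (y : EuclideanSpace ℝ (Fin N)) (t : ℝ), γ (y + t • e) = γ y)
    (hW : IsOpen W) (hmem : ∀ y ∈ W, y ∈ Ω ↔ γ y < ⟪e, y⟫)
    (hφ : ContDiff ℝ 1 φ) (hφc : HasCompactSupport φ) (hφW : tsupport φ ⊆ W)
    (hQ : ContDiffOn ℝ 1 Q Ω) (hQc : ContinuousOn Q (closure Ω))
    (hDc : ContinuousOn D (closure Ω)) (hD : ∀ x ∈ Ω, divergence Q x = D x) :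
    ∫ x in Ω, (φ x * D x + fderiv ℝ φ x (Q x)) =
      ∫ y : (ℝ ∙ e)ᗮ, φ (graphMap e γ y) *
        ⟪gradient γ (graphMap e γ y) - e, Q (graphMap e γ y)⟫ := by
  have hqc : ContinuousOn (fun x => φ x * ⟪gradient γ x - e, Q x⟫) (closure Ω) :=
    hφ.continuous.continuousOn.mul
      (((continuous_gradient hγ).sub continuous_const).continuousOn.inner hQc)
  have hlim := tendsto_integral_deriv_cutoff he hγ.continuous hinv hW hmem hqc
    ((tsupport_mul_subset_left (f := φ)).trans hφW) hφc.mul_right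
  refine tendsto_nhds_unique ?_ hlim
  refine Tendsto.congr' (eventually_mem_nhdsWithin.mono fun ε hε =>
    integral_eq_neg_of_cutoff hΩ hb hγ hmem hφ hφc hφW hQ hQc hDc hD hε) ?_
  have hac := continuousOn_divergence_smul hφ hQc hDc
  have hai := integrableOn_of_continuousOn_closure hb hac
  refine tendsto_integral_filter_of_dominated_convergence
    (fun x => ‖φ x * D x + fderiv ℝ φ x (Q x)‖) ?_ ?_ hai.norm ?_
  · refine Eventually.of_forall fun ε => AEStronglyMeasurable.mul ?_ hai.aestronglyMeasurable
    have h1 : Continuous fun x : EuclideanSpace ℝ (Fin N) => cutoff ((⟪e, x⟫ - γ x) / ε) := by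
      have := contDiff_cutoff.continuous
      have := hγ.continuous
      fun_prop
    exact h1.aestronglyMeasurable
  · refine Eventually.of_forall fun ε => Eventually.of_forall fun x => ?_
    rw [norm_mul]
    exact mul_le_of_le_one_left (norm_nonneg _) (abs_cutoff_le _)
  · refine (ae_restrict_iff' hΩ.measurableSet).2 (Eventually.of_forall fun x hx => ?_)
    by_cases h : x ∈ tsupport φ
    · have hpos : 0 < ⟪e, x⟫ - γ x := sub_pos.2 ((hmem x (hφW h)).1 hx)
      refine tendsto_const_nhds.congr' ?_
      have h1 : ∀ᶠ ε : ℝ in 𝓝[>] 0, ε < (⟪e, x⟫ - γ x) / 2 :=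
        nhdsWithin_le_nhds (eventually_lt_nhds (half_pos hpos))
      filter_upwards [h1, self_mem_nhdsWithin] with ε h2 h3
      have h3 : (0 : ℝ) < ε := h3
      rw [cutoff_of_ge, one_mul]
      rw [le_div_iff₀ h3]
      linarith
    · rw [fderiv_eq_zero_of_notMem_tsupport h, image_eq_zero_of_notMem_tsupport h]
      simp

/-- The normal is defined by a pointwise choice of coordinates; uniqueness lets one graph compute it
throughout W. -/
lemma outwardNormal_eq_of_graph (he : ‖e‖ = 1) (hγ : ContDiff ℝ 1 γ)
    (hinv : ∀ (y : EuclideanSpace ℝ (Fin N)) (t : ℝ), γ (y + t • e) = γ y)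
    (hC1 : HasC1Boundary Ω) (hW : IsOpen W) (hmem : ∀ y ∈ W, y ∈ Ω ↔ γ y < ⟪e, y⟫)
    {x : EuclideanSpace ℝ (Fin N)} (hxW : x ∈ W) (hx : x ∈ frontier Ω) :
    outwardNormal Ω x = ‖gradient γ x - e‖⁻¹ • (gradient γ x - e) :=
  (hC1.isOutwardUnitNormal hx).unique hx
    ⟨e, γ, ⟨he, hγ, hinv, eventually_of_mem (hW.mem_nhds hxW) hmem⟩, rfl⟩

theorem setIntegral_divergence_of_tsupport_subset (hΩ : IsOpen Ω) (hb : Bornology.IsBounded Ω)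
    (hC1 : HasC1Boundary Ω) (he : ‖e‖ = 1) (hγ : ContDiff ℝ 1 γ)
    (hinv : ∀ (y : EuclideanSpace ℝ (Fin N)) (t : ℝ), γ (y + t • e) = γ y)
    (hW : IsOpen W) (hmem : ∀ y ∈ W, y ∈ Ω ↔ γ y < ⟪e, y⟫)
    (hφ : ContDiff ℝ 1 φ) (hφc : HasCompactSupport φ) (hφW : tsupport φ ⊆ W)
    (hQ : ContDiffOn ℝ 1 Q Ω) (hQc : ContinuousOn Q (closure Ω))
    (hDc : ContinuousOn D (closure Ω)) (hD : ∀ x ∈ Ω, divergence Q x = D x) :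
    ∫ x in Ω, (φ x * D x + fderiv ℝ φ x (Q x)) =
      ∫ x in frontier Ω, φ x * ⟪Q x, outwardNormal Ω x⟫ ∂μHE[N - 1] := by
  rw [setIntegral_divergence_eq_integral_graph hΩ hb he hγ hinv hW hmem hφ hφc hφW hQ hQc hDc hD]
  set k : EuclideanSpace ℝ (Fin N) → ℝ := fun x =>
    φ x * ⟪Q x, ‖gradient γ x - e‖⁻¹ • (gradient γ x - e)⟫ with hk
  have hgm : MeasurableSet {x | γ x = ⟪e, x⟫} :=
    (isClosed_eq hγ.continuous (by fun_prop)).measurableSet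
  -- The boundary and the full graph may differ outside W, but φ vanishes there.
  have h1 : ∫ x in frontier Ω, φ x * ⟪Q x, outwardNormal Ω x⟫ ∂μHE[N - 1] =
      ∫ x in {x | γ x = ⟪e, x⟫}, k x ∂μHE[N - 1] := by
    rw [← integral_indicator isClosed_frontier.measurableSet, ← integral_indicator hgm]
    congr 1
    ext x
    by_cases hx : x ∈ tsupport φ
    · have h2 := mem_frontier_iff_graph he hγ.continuous hinv hΩ hW hmem (hφW hx)
      by_cases hf : x ∈ frontier Ω
      · rw [indicator_of_mem hf, indicator_of_mem (show x ∈ {x | γ x = ⟪e, x⟫} from h2.1 hf),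
          outwardNormal_eq_of_graph he hγ hinv hC1 hW hmem (hφW hx) hf]
      · rw [indicator_of_notMem hf,
          indicator_of_notMem (show x ∉ {x | γ x = ⟪e, x⟫} from fun h => hf (h2.2 h))]
    · have h3 := image_eq_zero_of_notMem_tsupport hx
      simp [indicator_apply, hk, h3]
  rw [h1, setIntegral_graph he hγ hinv]
  refine integral_congr_ae (Eventually.of_forall fun y => ?_)
  have hne : gradient γ (graphMap e γ y) - e ≠ 0 := by
    intro h
    have h2 := inner_gradient_eq_zero hγ hinv (graphMap e γ y)
    rw [sub_eq_zero.1 h, real_inner_self_eq_norm_sq, he] at h2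
    norm_num at h2
  have hne' := norm_ne_zero_iff.2 hne
  simp only [hk, real_inner_smul_right]
  rw [real_inner_comm]
  field_simp

end LocalDivergence

/-! ### The divergence theorem on Ω. -/

section GlobalDivergence

variable {N : ℕ} {Ω : Set (EuclideanSpace ℝ (Fin N))}
  {D : EuclideanSpace ℝ (Fin N) → ℝ}
  {Q : EuclideanSpace ℝ (Fin N) → EuclideanSpace ℝ (Fin N)}

lemma IsC1GraphAt.exists_isOpen {x e : EuclideanSpace ℝ (Fin N)}
    {γ : EuclideanSpace ℝ (Fin N) → ℝ} (h : IsC1GraphAt Ω x e γ) :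
    ∃ W, IsOpen W ∧ x ∈ W ∧ ∀ y ∈ W, y ∈ Ω ↔ γ y < ⟪e, y⟫ := by
  obtain ⟨W, hW, hWo, hxW⟩ := mem_nhds_iff.1 h.mem_iff
  exact ⟨W, hWo, hxW, fun y hy => hW hy⟩

lemma continuousOn_outwardNormal (hC1 : HasC1Boundary Ω) :
    ContinuousOn (outwardNormal Ω) (frontier Ω) := by
  intro x hx
  obtain ⟨e, γ, hg⟩ := hC1 x hx
  obtain ⟨W, hWo, hxW, hmem⟩ := hg.exists_isOpen
  have hev : ∀ᶠ y in 𝓝[frontier Ω] x,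
      outwardNormal Ω y = ‖gradient γ y - e‖⁻¹ • (gradient γ y - e) := by
    filter_upwards [self_mem_nhdsWithin, mem_nhdsWithin_of_mem_nhds (hWo.mem_nhds hxW)]
      with y hy hyW
    exact outwardNormal_eq_of_graph hg.norm_eq_one hg.contDiff hg.invariant hC1 hWo hmem hyW hy
  have hc : Continuous fun y => gradient γ y - e :=
    (continuous_gradient hg.contDiff).sub continuous_const
  have hcont : ContinuousAt (fun y => ‖gradient γ y - e‖⁻¹ • (gradient γ y - e)) x :=
    (hc.norm.continuousAt.inv₀ (norm_ne_zero_iff.2 hg.sub_ne_zero)).smul hc.continuousAt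
  exact hcont.continuousWithinAt.congr_of_eventuallyEq hev
    (outwardNormal_eq_of_graph hg.norm_eq_one hg.contDiff hg.invariant hC1 hWo hmem hxW hx)

lemma measure_frontier_lt_top (hΩ : IsOpen Ω) (hb : Bornology.IsBounded Ω)
    (hC1 : HasC1Boundary Ω) : μHE[N - 1] (frontier Ω) < ⊤ := by
  have hcomp : IsCompact (frontier Ω) :=
    hb.isCompact_closure.of_isClosed_subset isClosed_frontier frontier_subset_closure
  refine hcomp.measure_lt_top_of_nhdsWithin fun x hx => ?_
  obtain ⟨e, γ, hg⟩ := hC1 x hx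
  obtain ⟨W, hWo, hxW, hmem⟩ := hg.exists_isOpen
  refine ⟨frontier Ω ∩ (W ∩ Metric.ball x 1), inter_mem self_mem_nhdsWithin
    (mem_nhdsWithin_of_mem_nhds (inter_mem (hWo.mem_nhds hxW) (Metric.ball_mem_nhds x one_pos))),
    ?_⟩
  refine lt_of_le_of_lt (measure_mono ?_) (measure_graph_inter_lt_top hg.norm_eq_one hg.contDiff
    hg.invariant (Metric.isBounded_ball (x := x) (r := 1)) Metric.isOpen_ball.measurableSet)
  rintro y ⟨hy, hyW, hyB⟩
  exact ⟨hyB, (mem_frontier_iff_graph hg.norm_eq_one hg.contDiff.continuous hg.invariant hΩ hWo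
    hmem hyW).1 hy⟩

lemma integrableOn_frontier (hΩ : IsOpen Ω) (hb : Bornology.IsBounded Ω)
    (hC1 : HasC1Boundary Ω) {k : EuclideanSpace ℝ (Fin N) → ℝ}
    (hk : ContinuousOn k (frontier Ω)) : IntegrableOn k (frontier Ω) μHE[N - 1] := by
  have hcomp : IsCompact (frontier Ω) :=
    hb.isCompact_closure.of_isClosed_subset isClosed_frontier frontier_subset_closure
  obtain ⟨M, hM⟩ := hcomp.exists_bound_of_continuousOn hk
  exact ⟨hk.aestronglyMeasurable isClosed_frontier.measurableSet,
    .restrict_of_bounded (C := M) (measure_frontier_lt_top hΩ hb hC1)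
      ((ae_restrict_iff' isClosed_frontier.measurableSet).2 (Eventually.of_forall hM))⟩

/-- Both sides are zero: φQ has compact support in Ω. -/
lemma setIntegral_divergence_of_tsupport_subset_interior (hΩ : IsOpen Ω)
    {φ : EuclideanSpace ℝ (Fin N) → ℝ}
    (hφ : ContDiff ℝ 1 φ) (hφc : HasCompactSupport φ) (hφΩ : tsupport φ ⊆ Ω)
    (hQ : ContDiffOn ℝ 1 Q Ω) (hD : ∀ x ∈ Ω, divergence Q x = D x) :
    ∫ x in Ω, (φ x * D x + fderiv ℝ φ x (Q x)) =
      ∫ x in frontier Ω, φ x * ⟪Q x, outwardNormal Ω x⟫ ∂μHE[N - 1] := by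
  have hzero : ∀ x ∉ Ω, (fun y => φ y • Q y) =ᶠ[𝓝 x] fun _ => 0 := by
    intro x hx
    filter_upwards [notMem_tsupport_iff_eventuallyEq.1 fun h => hx (hφΩ h)] with y hy
    rw [hy, Pi.zero_apply, zero_smul]
  have hR : ContDiff ℝ 1 fun y => φ y • Q y := by
    refine contDiff_iff_contDiffAt.2 fun x => ?_
    by_cases hx : x ∈ Ω
    · exact hφ.contDiffAt.smul (hQ.contDiffAt (hΩ.mem_nhds hx))
    · exact contDiffAt_const.congr_of_eventuallyEq (hzero x hx)
  have h0 := integral_divergence_eq_zero hR hφc.smul_right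
  have hdiv : ∀ x ∈ Ω, divergence (fun y => φ y • Q y) x =
      φ x * D x + fderiv ℝ φ x (Q x) := by
    intro x hx
    rw [divergence_smul (hφ.differentiable one_ne_zero x)
      ((hQ.contDiffAt (hΩ.mem_nhds hx)).differentiableAt one_ne_zero), hD x hx]
  have hdiv0 : ∀ x ∉ Ω, divergence (fun y => φ y • Q y) x = 0 := fun x hx => by
    rw [divergence_congr (hzero x hx), divergence_zero]
  rw [← setIntegral_eq_integral_of_forall_compl_eq_zero hdiv0,
    setIntegral_congr_fun hΩ.measurableSet hdiv] at h0
  refine h0.trans (setIntegral_eq_zero_of_forall_eq_zero fun x hx => ?_).symm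
  rw [hΩ.frontier_eq] at hx
  rw [image_eq_zero_of_notMem_tsupport fun h => hx.2 (hφΩ h), zero_mul]

/-- The divergence theorem on a bounded open set with `C¹` boundary, for a vector field that is
`C¹` inside and, together with its divergence, continuous up to the boundary. -/
theorem integral_divergence_eq_integral_frontier (hΩ : IsOpen Ω) (hb : Bornology.IsBounded Ω)
    (hC1 : HasC1Boundary Ω) (hQ : ContDiffOn ℝ 1 Q Ω) (hQc : ContinuousOn Q (closure Ω))
    (hDc : ContinuousOn D (closure Ω)) (hD : ∀ x ∈ Ω, divergence Q x = D x) :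
    ∫ x in Ω, D x = ∫ x in frontier Ω, ⟪Q x, outwardNormal Ω x⟫ ∂μHE[N - 1] := by
  have hloc : ∀ x ∈ closure Ω, ∃ W, IsOpen W ∧ x ∈ W ∧ ∀ φ : EuclideanSpace ℝ (Fin N) → ℝ,
      ContDiff ℝ 1 φ → HasCompactSupport φ → tsupport φ ⊆ W →
      ∫ x in Ω, (φ x * D x + fderiv ℝ φ x (Q x)) =
        ∫ x in frontier Ω, φ x * ⟪Q x, outwardNormal Ω x⟫ ∂μHE[N - 1] := by
    intro x hx
    by_cases hxΩ : x ∈ Ω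
    · exact ⟨Ω, hΩ, hxΩ, fun φ h1 h2 h3 =>
        setIntegral_divergence_of_tsupport_subset_interior hΩ h1 h2 h3 hQ hD⟩
    · have hxf : x ∈ frontier Ω := by
        rw [hΩ.frontier_eq]
        exact ⟨hx, hxΩ⟩
      obtain ⟨e, γ, hg⟩ := hC1 x hxf
      obtain ⟨W, hWo, hxW, hmem⟩ := hg.exists_isOpen
      exact ⟨W, hWo, hxW, fun φ h1 h2 h3 => setIntegral_divergence_of_tsupport_subset hΩ hb hC1
        hg.norm_eq_one hg.contDiff hg.invariant hWo hmem h1 h2 h3 hQ hQc hDc hD⟩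
  choose! W hWo hxW hloc using hloc
  have hbump : ∀ x ∈ closure Ω, ∃ b : ContDiffBump x, Metric.closedBall x b.rOut ⊆ W x := by
    intro x hx
    obtain ⟨r, hr, hrW⟩ := Metric.nhds_basis_closedBall.mem_iff.1 ((hWo x hx).mem_nhds (hxW x hx))
    exact ⟨⟨r / 2, r, half_pos hr, half_lt_self hr⟩, hrW⟩
  choose! b hbW using hbump
  obtain ⟨t, htΩ, ht⟩ := hb.isCompact_closure.elim_nhds_subcover
    (fun x => Metric.closedBall x (b x).rIn)
    fun x _ => Metric.closedBall_mem_nhds x (b x).rIn_pos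
  have hbC : ∀ x, ContDiff ℝ 1 (b x) := fun x => (b x).contDiff
  have hprod : ∀ s : Finset (EuclideanSpace ℝ (Fin N)),
      ContDiff ℝ 1 fun y => ∏ i ∈ s, (1 - b i y) := fun s =>
    contDiff_prod fun i _ => contDiff_const.sub (hbC i)
  have hiΩ : ∀ φ : EuclideanSpace ℝ (Fin N) → ℝ, ContDiff ℝ 1 φ →
      IntegrableOn (fun x => φ x * D x + fderiv ℝ φ x (Q x)) Ω := fun φ hφ =>
    integrableOn_of_continuousOn_closure hb (continuousOn_divergence_smul hφ hQc hDc)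
  have hi : ∀ φ : EuclideanSpace ℝ (Fin N) → ℝ, ContDiff ℝ 1 φ →
      IntegrableOn (fun x => φ x * ⟪Q x, outwardNormal Ω x⟫) (frontier Ω) μHE[N - 1] :=
    fun φ hφ => integrableOn_frontier hΩ hb hC1 (hφ.continuous.continuousOn.mul
      ((hQc.mono frontier_subset_closure).inner (continuousOn_outwardNormal hC1)))
  -- A partition of unity by telescoping: inserting a adds b_a ∏(1 − b_i) to 1 − ∏(1 − b_i), and
  -- this increment is supported in the single neighbourhood `W a`. The identity is additive in η.
  have hind : ∀ s : Finset (EuclideanSpace ℝ (Fin N)), (∀ x ∈ s, x ∈ closure Ω) →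
      ∀ η : EuclideanSpace ℝ (Fin N) → ℝ, η = (fun y => 1 - ∏ i ∈ s, (1 - b i y)) →
      ∫ x in Ω, (η x * D x + fderiv ℝ η x (Q x)) =
        ∫ x in frontier Ω, η x * ⟪Q x, outwardNormal Ω x⟫ ∂μHE[N - 1] := by
    classical
    intro s
    induction s using Finset.induction_on with
    | empty =>
      rintro - η rfl
      simp
    | insert a s has ih =>
      rintro hs η rfl
      set η₁ : EuclideanSpace ℝ (Fin N) → ℝ := fun y => 1 - ∏ i ∈ s, (1 - b i y) with hη₁
      set η₂ : EuclideanSpace ℝ (Fin N) → ℝ := fun y => b a y * ∏ i ∈ s, (1 - b i y) with hη₂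
      have e1 : (fun y => 1 - ∏ i ∈ insert a s, (1 - b i y)) = fun y => η₁ y + η₂ y := by
        ext y
        rw [Finset.prod_insert has, hη₁, hη₂]
        ring
      have c1 : ContDiff ℝ 1 η₁ := contDiff_const.sub (hprod s)
      have c2 : ContDiff ℝ 1 η₂ := (hbC a).mul (hprod s)
      have haΩ := hs a (Finset.mem_insert_self _ _)
      have h1 := ih (fun x hx => hs x (Finset.mem_insert_of_mem hx)) η₁ rfl
      have h2 := hloc a haΩ η₂ c2 (b a).hasCompactSupport.mul_right
        ((tsupport_mul_subset_left (f := b a)).trans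
          ((b a).tsupport_eq.subset.trans (hbW a haΩ)))
      rw [e1]
      have e2 : ∀ x, (η₁ x + η₂ x) * D x + fderiv ℝ (fun y => η₁ y + η₂ y) x (Q x) =
          (η₁ x * D x + fderiv ℝ η₁ x (Q x)) + (η₂ x * D x + fderiv ℝ η₂ x (Q x)) := by
        intro x
        rw [fderiv_fun_add (c1.differentiable one_ne_zero x) (c2.differentiable one_ne_zero x),
          add_apply]
        ring
      simp only [e2]
      simp only [add_mul]
      rw [integral_add (hiΩ _ c1) (hiΩ _ c2), integral_add (hi _ c1) (hi _ c2), h1, h2]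
  -- Every point of the closure lies in an inner ball, where some factor 1 − b_i is zero.
  have hone : ∀ x ∈ closure Ω, 1 - ∏ i ∈ t, (1 - b i x) = 1 := by
    intro x hx
    obtain ⟨i, hit, hxi⟩ := mem_iUnion₂.1 (ht hx)
    rw [Finset.prod_eq_zero hit, sub_zero]
    rw [(b i).one_of_mem_closedBall hxi, sub_self]
  have hfin := hind t htΩ _ rfl
  rw [setIntegral_congr_fun hΩ.measurableSet (g := D), setIntegral_congr_fun
    isClosed_frontier.measurableSet (g := fun x => ⟪Q x, outwardNormal Ω x⟫)] at hfin
  · exact hfin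
  · intro x hx
    simp only [hone x (frontier_subset_closure hx), one_mul]
  · intro x hx
    have h1 : (fun y => 1 - ∏ i ∈ t, (1 - b i y)) =ᶠ[𝓝 x] fun _ => 1 :=
      eventually_of_mem (hΩ.mem_nhds hx) fun y hy => hone y (subset_closure hy)
    simp only [h1.fderiv_eq, hone x (subset_closure hx), one_mul]
    simp

end GlobalDivergence

/-! ### The weighted radial field |x|^α x. -/

section PowerField

variable {N : ℕ}

lemma hasFDerivAt_norm_rpow_of_ne_zero {x : EuclideanSpace ℝ (Fin N)} (hx : x ≠ 0) (α : ℝ) :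
    HasFDerivAt (fun y : EuclideanSpace ℝ (Fin N) => ‖y‖ ^ α)
      ((α * ‖x‖ ^ (α - 2)) • innerSL ℝ x) x := by
  have h1 : HasFDerivAt (fun y : EuclideanSpace ℝ (Fin N) => ‖y‖ ^ 2) (2 • innerSL ℝ x) x :=
    (hasStrictFDerivAt_norm_sq x).hasFDerivAt
  have h2 := h1.rpow_const (p := α / 2) (Or.inl (pow_ne_zero 2 (norm_ne_zero_iff.2 hx)))
  have h3 : ∀ (y : EuclideanSpace ℝ (Fin N)) (r : ℝ), (‖y‖ ^ 2) ^ (r / 2) = ‖y‖ ^ r := by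
    intro y r
    rw [← Real.rpow_natCast, ← Real.rpow_mul (norm_nonneg _)]
    congr 1
    push_cast
    ring
  simp only [h3] at h2
  have h4 : (α * ‖x‖ ^ (α - 2)) • innerSL ℝ x =
      (α / 2 * (‖x‖ ^ 2) ^ (α / 2 - 1)) • 2 • innerSL ℝ x := by
    rw [show α / 2 - 1 = (α - 2) / 2 by ring, h3, ← Nat.cast_smul_eq_nsmul ℝ, smul_smul]
    congr 1
    push_cast
    ring
  rw [h4]
  exact h2

lemma contDiffAt_norm_rpow_of_ne_zero {x : EuclideanSpace ℝ (Fin N)} (hx : x ≠ 0) (α : ℝ) :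
    ContDiffAt ℝ 1 (fun y : EuclideanSpace ℝ (Fin N) => ‖y‖ ^ α) x :=
  (contDiffAt_norm ℝ hx).rpow_const_of_ne (norm_ne_zero_iff.2 hx)

/-- The general derivative formula remains valid at the origin: whatever value 0^(α−2) takes, it
multiplies a zero vector. -/
lemma norm_rpow_smul_self_fderiv_zero {α : ℝ} (hα : 0 < α) :
    ‖(0 : EuclideanSpace ℝ (Fin N))‖ ^ α •
        ContinuousLinearMap.id ℝ (EuclideanSpace ℝ (Fin N)) +
      ((α * ‖(0 : EuclideanSpace ℝ (Fin N))‖ ^ (α - 2)) •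
        innerSL ℝ (0 : EuclideanSpace ℝ (Fin N))).smulRight 0 = 0 := by
  refine ContinuousLinearMap.ext fun z => ?_
  rw [norm_zero, Real.zero_rpow hα.ne']
  simp

lemma hasFDerivAt_norm_rpow_smul_self {α : ℝ} (hα : 0 < α) (x : EuclideanSpace ℝ (Fin N)) :
    HasFDerivAt (fun y : EuclideanSpace ℝ (Fin N) => ‖y‖ ^ α • y)
      (‖x‖ ^ α • ContinuousLinearMap.id ℝ (EuclideanSpace ℝ (Fin N)) +
        ((α * ‖x‖ ^ (α - 2)) • innerSL ℝ x).smulRight x) x := by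
  by_cases hx : x = 0
  · subst hx
    have h0 : Tendsto (fun y : EuclideanSpace ℝ (Fin N) => ‖y‖ ^ α) (𝓝 0) (𝓝 0) := by
      have h1 : Continuous fun y : EuclideanSpace ℝ (Fin N) => ‖y‖ ^ α :=
        continuous_norm.rpow_const fun _ => Or.inr hα.le
      have h2 := h1.tendsto 0
      rwa [norm_zero, Real.zero_rpow hα.ne'] at h2
    rw [norm_rpow_smul_self_fderiv_zero hα, hasFDerivAt_iff_isLittleO_nhds_zero]
    simp only [zero_add, smul_zero, sub_zero]
    have h3 : (fun y : EuclideanSpace ℝ (Fin N) => ‖y‖ ^ α) =o[𝓝 0]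
        (fun _ => (1 : ℝ)) := (Asymptotics.isLittleO_one_iff ℝ).2 h0
    have h4 := h3.smul_isBigO (Asymptotics.isBigO_refl
      (fun y : EuclideanSpace ℝ (Fin N) => y) (𝓝 0))
    simpa using h4
  · exact (hasFDerivAt_norm_rpow_of_ne_zero hx α).smul (hasFDerivAt_id x)

/-- The weight |x|^α may fail to be differentiable at 0, but the field is C¹: for α > 0 its
derivative is bounded by (1 + α)|x|^α. The case α = 0 is the identity and is separate because 0^0 =
1. -/
lemma contDiff_norm_rpow_smul_self {α : ℝ} (hα : 0 ≤ α) :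
    ContDiff ℝ 1 fun y : EuclideanSpace ℝ (Fin N) => ‖y‖ ^ α • y := by
  rcases hα.eq_or_lt with rfl | hα
  · simpa using contDiff_fun_id
  refine contDiff_one_iff_fderiv.2 ⟨fun x => (hasFDerivAt_norm_rpow_smul_self hα x).differentiableAt,
    continuous_iff_continuousAt.2 fun x => ?_⟩
  by_cases hx : x = 0
  · subst hx
    have h0 : Tendsto (fun y : EuclideanSpace ℝ (Fin N) => (1 + α) * ‖y‖ ^ α) (𝓝 0) (𝓝 0) := by
      have h1 : Continuous fun y : EuclideanSpace ℝ (Fin N) => (1 + α) * ‖y‖ ^ α :=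
        continuous_const.mul (continuous_norm.rpow_const fun _ => Or.inr hα.le)
      have h2 := h1.tendsto 0
      rwa [norm_zero, Real.zero_rpow hα.ne', mul_zero] at h2
    have hz : fderiv ℝ (fun y : EuclideanSpace ℝ (Fin N) => ‖y‖ ^ α • y) 0 = 0 := by
      rw [(hasFDerivAt_norm_rpow_smul_self hα 0).fderiv, norm_rpow_smul_self_fderiv_zero hα]
    rw [ContinuousAt, hz]
    refine squeeze_zero_norm (fun y => ?_) h0
    rw [(hasFDerivAt_norm_rpow_smul_self hα y).fderiv]
    by_cases hy : y = 0
    · subst hy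
      rw [norm_rpow_smul_self_fderiv_zero hα]
      simp [Real.zero_rpow hα.ne']
    refine (norm_add_le _ _).trans ?_
    rw [add_mul, one_mul]
    refine add_le_add ?_ ?_
    · rw [norm_smul, Real.norm_of_nonneg (by positivity)]
      exact mul_le_of_le_one_right (by positivity) ContinuousLinearMap.norm_id_le
    · rw [ContinuousLinearMap.norm_smulRight_apply, norm_smul, innerSL_apply_norm,
        Real.norm_of_nonneg (by positivity)]
      have hy' : 0 < ‖y‖ := norm_pos_iff.2 hy
      have : ‖y‖ ^ α = ‖y‖ ^ (α - 2) * ‖y‖ ^ (2 : ℝ) := by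
        rw [← Real.rpow_add hy']
        ring_nf
      rw [this, Real.rpow_two]
      exact le_of_eq (by ring)
  · exact ((contDiffAt_norm_rpow_of_ne_zero hx α).smul contDiffAt_id).continuousAt_fderiv
      one_ne_zero

lemma divergence_id (x : EuclideanSpace ℝ (Fin N)) : divergence (fun y => y) x = N := by
  rw [divergence, show fderiv ℝ (fun y : EuclideanSpace ℝ (Fin N) => y) x = _ from fderiv_id]
  have := LinearMap.trace_id ℝ (EuclideanSpace ℝ (Fin N))
  rw [finrank_euclideanSpace, Fintype.card_fin] at this
  exact this

lemma divergence_norm_rpow_smul_self {α : ℝ} (hα : 0 ≤ α) (x : EuclideanSpace ℝ (Fin N)) :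
    divergence (fun y => ‖y‖ ^ α • y) x = (N + α) * ‖x‖ ^ α := by
  rcases hα.eq_or_lt with rfl | hα
  · simpa using divergence_id x
  by_cases hx : x = 0
  · subst hx
    rw [divergence, (hasFDerivAt_norm_rpow_smul_self hα 0).fderiv,
      norm_rpow_smul_self_fderiv_zero hα]
    simp [Real.zero_rpow hα.ne']
  · have h := hasFDerivAt_norm_rpow_of_ne_zero hx α
    rw [divergence_smul h.differentiableAt differentiableAt_fun_id, divergence_id, h.fderiv]
    have hx' : 0 < ‖x‖ := norm_pos_iff.2 hx
    have h2 : ‖x‖ ^ α = ‖x‖ ^ (α - 2) * ‖x‖ ^ (2 : ℝ) := by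
      rw [← Real.rpow_add hx']
      ring_nf
    simp only [smul_apply, innerSL_apply_apply, real_inner_self_eq_norm_sq, smul_eq_mul]
    rw [h2, Real.rpow_two]
    ring

end PowerField

/-! ### Gradients up to the boundary. -/

section ClosureGradient

variable {N : ℕ} {Ω : Set (EuclideanSpace ℝ (Fin N))} {u : EuclideanSpace ℝ (Fin N) → ℝ}

/-- At a boundary point the tangent cone contains the open half-space of inward directions, which
spans. This is what makes `fderivWithin` continuous up to the boundary for u of class C¹ there. -/
lemma uniqueDiffOn_closure (hΩ : IsOpen Ω) (hC1 : HasC1Boundary Ω) :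
    UniqueDiffOn ℝ (closure Ω) := by
  intro x hx
  by_cases hxΩ : x ∈ Ω
  · exact (hΩ.uniqueDiffWithinAt hxΩ).mono subset_closure
  have hxf : x ∈ frontier Ω := by
    rw [hΩ.frontier_eq]
    exact ⟨hx, hxΩ⟩
  obtain ⟨e, γ, hg⟩ := hC1 x hxf
  have hcone : {d | ⟪gradient γ x - e, d⟫ < 0} ⊆ tangentConeAt ℝ (closure Ω) x := by
    intro d hd
    have h1 := (hasDerivWithinAt_iff_tendsto_slope' (by simp)).1
      ((hg.hasDerivAt d).hasDerivWithinAt (s := Ioi 0))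
    have hl : Tendsto (fun t : ℝ => x + t • d) (𝓝[>] 0) (𝓝 x) := by
      have h2 : Continuous fun t : ℝ => x + t • d := by fun_prop
      have h3 := h2.tendsto 0
      simp only [zero_smul, add_zero] at h3
      exact h3.mono_left nhdsWithin_le_nhds
    have hin : ∀ᶠ t : ℝ in 𝓝[>] 0, x + t • d ∈ closure Ω := by
      filter_upwards [h1.eventually_lt_const hd, hl.eventually hg.mem_iff, self_mem_nhdsWithin]
        with t ht hm ht0
      have ht0 : (0 : ℝ) < t := ht0
      simp only [slope_def_field, zero_smul, add_zero, hg.eq_inner hxf, sub_self, sub_zero] at ht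
      have h4 := (div_neg_iff.1 ht).resolve_left fun h => absurd h.2 ht0.not_gt
      exact subset_closure (hm.2 (by linarith [h4.1]))
    refine mem_tangentConeAt_of_seq (𝓝[>] (0 : ℝ)) (fun t => t⁻¹) (fun t => t • d) ?_ hin ?_
    · have h2 : Continuous fun t : ℝ => t • d := by fun_prop
      have h3 := h2.tendsto 0
      rw [zero_smul] at h3
      exact h3.mono_left nhdsWithin_le_nhds
    · refine tendsto_const_nhds.congr' ?_
      filter_upwards [self_mem_nhdsWithin] with t ht
      have ht : (0 : ℝ) < t := ht
      rw [smul_smul, inv_mul_cancel₀ ht.ne', one_smul]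
  refine ⟨?_, subset_closure hx⟩
  have hopen : IsOpen {d | ⟪gradient γ x - e, d⟫ < 0} :=
    isOpen_lt (by fun_prop) continuous_const
  have htop : Submodule.span ℝ (tangentConeAt ℝ (closure Ω) x) = ⊤ := by
    refine Submodule.eq_top_of_nonempty_interior' _ ⟨-(gradient γ x - e), ?_⟩
    refine mem_interior.2 ⟨_, hcone.trans Submodule.subset_span, hopen, ?_⟩
    change ⟪gradient γ x - e, -(gradient γ x - e)⟫ < 0
    rw [inner_neg_right, neg_lt_zero, real_inner_self_eq_norm_sq]
    exact pow_pos (norm_pos_iff.2 hg.sub_ne_zero) 2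
  rw [htop]
  exact dense_univ

/-- The gradient of `u`, up to the boundary of `Ω`. -/
noncomputable def closureGradient (Ω : Set (EuclideanSpace ℝ (Fin N)))
    (u : EuclideanSpace ℝ (Fin N) → ℝ) (x : EuclideanSpace ℝ (Fin N)) :
    EuclideanSpace ℝ (Fin N) :=
  (InnerProductSpace.toDual ℝ _).symm (fderivWithin ℝ u (closure Ω) x)

lemma inner_closureGradient (x z : EuclideanSpace ℝ (Fin N)) :
    ⟪closureGradient Ω u x, z⟫ = fderivWithin ℝ u (closure Ω) x z :=
  InnerProductSpace.toDual_symm_apply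

lemma normalDeriv_eq_inner (x : EuclideanSpace ℝ (Fin N)) :
    normalDeriv Ω u x = ⟪closureGradient Ω u x, outwardNormal Ω x⟫ :=
  (inner_closureGradient _ _).symm

lemma continuousOn_closureGradient (hΩ : IsOpen Ω) (hC1 : HasC1Boundary Ω)
    (hu : ContDiffOn ℝ 1 u (closure Ω)) : ContinuousOn (closureGradient Ω u) (closure Ω) :=
  (InnerProductSpace.toDual ℝ _).symm.continuous.comp_continuousOn
    (hu.continuousOn_fderivWithin (uniqueDiffOn_closure hΩ hC1) le_rfl)

lemma closureGradient_eventuallyEq (hΩ : IsOpen Ω) {x : EuclideanSpace ℝ (Fin N)} (hx : x ∈ Ω) :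
    closureGradient Ω u =ᶠ[𝓝 x] fun y => (InnerProductSpace.toDual ℝ _).symm (fderiv ℝ u y) := by
  filter_upwards [hΩ.mem_nhds hx] with y hy
  rw [closureGradient, fderivWithin_of_mem_nhds (mem_of_superset (hΩ.mem_nhds hy) subset_closure)]

lemma hasFDerivAt_of_mem (hΩ : IsOpen Ω) (hu : ContDiffOn ℝ 2 u Ω)
    {x : EuclideanSpace ℝ (Fin N)} (hx : x ∈ Ω) :
    HasFDerivAt u (innerSL ℝ (closureGradient Ω u x)) x := by
  have h1 := ((hu.contDiffAt (hΩ.mem_nhds hx)).differentiableAt two_ne_zero).hasFDerivAt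
  have h2 : innerSL ℝ (closureGradient Ω u x) = fderiv ℝ u x := by
    refine ContinuousLinearMap.ext fun z => ?_
    rw [innerSL_apply_apply, inner_closureGradient,
      fderivWithin_of_mem_nhds (mem_of_superset (hΩ.mem_nhds hx) subset_closure)]
  rwa [h2]

lemma contDiffOn_closureGradient (hΩ : IsOpen Ω) (hu : ContDiffOn ℝ 2 u Ω) :
    ContDiffOn ℝ 1 (closureGradient Ω u) Ω := by
  intro x hx
  have h1 : ContDiffAt ℝ 1 (fderiv ℝ u) x :=
    (hu.contDiffAt (hΩ.mem_nhds hx)).fderiv_right (by norm_num)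
  have h2 : ContDiffAt ℝ 1 (fun y => (InnerProductSpace.toDual ℝ _).symm (fderiv ℝ u y)) x :=
    (InnerProductSpace.toDual ℝ _).symm.contDiff.contDiffAt.comp x h1
  exact (h2.congr_of_eventuallyEq (closureGradient_eventuallyEq hΩ hx)).contDiffWithinAt

lemma inner_fderiv_closureGradient (hΩ : IsOpen Ω) (hu : ContDiffOn ℝ 2 u Ω)
    {x : EuclideanSpace ℝ (Fin N)} (hx : x ∈ Ω) (z w : EuclideanSpace ℝ (Fin N)) :
    ⟪fderiv ℝ (closureGradient Ω u) x z, w⟫ = fderiv ℝ (fderiv ℝ u) x z w := by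
  have h1 : DifferentiableAt ℝ (fderiv ℝ u) x :=
    ((hu.contDiffAt (hΩ.mem_nhds hx)).fderiv_right (m := 1) (by norm_num)).differentiableAt
      one_ne_zero
  have h2 := ((InnerProductSpace.toDual ℝ
    (EuclideanSpace ℝ (Fin N))).symm.toContinuousLinearEquiv.toContinuousLinearMap.hasFDerivAt
      (x := fderiv ℝ u x)).comp x h1.hasFDerivAt
  have h3 : fderiv ℝ (fun y => (InnerProductSpace.toDual ℝ
      (EuclideanSpace ℝ (Fin N))).symm (fderiv ℝ u y)) x = _ := h2.fderiv
  rw [(closureGradient_eventuallyEq hΩ hx).fderiv_eq, h3]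
  exact InnerProductSpace.toDual_symm_apply

/-- Symmetry of the Hessian, in the form required by `divergence_rellich`. -/
lemma inner_fderiv_closureGradient_symm (hΩ : IsOpen Ω) (hu : ContDiffOn ℝ 2 u Ω)
    {x : EuclideanSpace ℝ (Fin N)} (hx : x ∈ Ω) (z w : EuclideanSpace ℝ (Fin N)) :
    ⟪fderiv ℝ (closureGradient Ω u) x z, w⟫ = ⟪fderiv ℝ (closureGradient Ω u) x w, z⟫ := by
  rw [inner_fderiv_closureGradient hΩ hu hx, inner_fderiv_closureGradient hΩ hu hx]
  exact (hu.contDiffAt (hΩ.mem_nhds hx)).isSymmSndFDerivAt (by simp) z w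

lemma divergence_closureGradient (hΩ : IsOpen Ω) (hu : ContDiffOn ℝ 2 u Ω)
    {x : EuclideanSpace ℝ (Fin N)} (hx : x ∈ Ω) :
    divergence (closureGradient Ω u) x = (Δ u) x := by
  set b := EuclideanSpace.basisFun (Fin N) ℝ
  rw [divergence, LinearMap.trace_eq_sum_inner _ b,
    InnerProductSpace.laplacian_eq_iteratedFDeriv_orthonormalBasis u b]
  refine Finset.sum_congr rfl fun i _ => ?_
  rw [iteratedFDeriv_two_apply, real_inner_comm]
  exact inner_fderiv_closureGradient hΩ hu hx _ _

lemma closureGradient_eq_smul_normal (hΩ : IsOpen Ω) (hC1 : HasC1Boundary Ω)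
    (hu : ContDiffOn ℝ 1 u (closure Ω)) (hu0 : ∀ x ∈ frontier Ω, u x = 0)
    {x : EuclideanSpace ℝ (Fin N)} (hx : x ∈ frontier Ω) :
    closureGradient Ω u x = normalDeriv Ω u x • outwardNormal Ω x := by
  obtain ⟨e, γ, hg⟩ := hC1 x hx
  obtain ⟨W, hWo, hxW, hmem⟩ := hg.exists_isOpen
  have hν := outwardNormal_eq_of_graph hg.norm_eq_one hg.contDiff hg.invariant hC1 hWo hmem hxW hx
  have hdu := (hu.differentiableOn one_ne_zero x (frontier_subset_closure hx)).hasFDerivWithinAt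
  have key : ∀ d, ⟪closureGradient Ω u x, d⟫ =
      -(⟪gradient γ x - e, d⟫ * ⟪closureGradient Ω u x, e⟫) := by
    intro d
    -- The line x + td moved along e onto the graph: c stays in the boundary, so u ∘ c vanishes near
    -- 0, and its derivative there expresses ⟪∇u, d⟫ through ⟪∇u, e⟫.
    set c : ℝ → EuclideanSpace ℝ (Fin N) := fun t =>
      x + t • d + (γ (x + t • d) - ⟪e, x + t • d⟫) • e with hc
    have hl : HasDerivAt (fun t : ℝ => x + t • d) d 0 := by
      simpa using ((hasDerivAt_id (0 : ℝ)).smul_const d).const_add x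
    have hcd : HasDerivAt c (d + ⟪gradient γ x - e, d⟫ • e) 0 :=
      hl.add ((hg.hasDerivAt d).smul_const e)
    have hc0 : c 0 = x := by
      simp only [hc, zero_smul, add_zero, hg.eq_inner hx, sub_self]
    have hcW : ∀ᶠ t in 𝓝 (0 : ℝ), c t ∈ frontier Ω := by
      have h1 : ∀ᶠ t in 𝓝 (0 : ℝ), c t ∈ W :=
        hcd.continuousAt.eventually (by rw [hc0]; exact hWo.mem_nhds hxW)
      filter_upwards [h1] with t ht
      rw [mem_frontier_iff_graph hg.norm_eq_one hg.contDiff.continuous hg.invariant hΩ hWo hmem ht]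
      simp only [hc]
      rw [hg.invariant, inner_add_right _ (x + t • d), real_inner_smul_right,
        real_inner_self_eq_norm_sq, hg.norm_eq_one]
      ring
    have h2 : HasDerivAt (fun t => u (c t))
        (fderivWithin ℝ u (closure Ω) x (d + ⟪gradient γ x - e, d⟫ • e)) 0 := by
      have h3 : HasFDerivWithinAt u (fderivWithin ℝ u (closure Ω) x) (closure Ω) (c 0) := by
        rw [hc0]
        exact hdu
      exact h3.comp_hasDerivAt 0 hcd (hcW.mono fun t ht => frontier_subset_closure ht)
    have h4 : HasDerivAt (fun t => u (c t)) 0 0 :=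
      (hasDerivAt_const (0 : ℝ) (0 : ℝ)).congr_of_eventuallyEq (hcW.mono fun t ht => hu0 _ ht)
    have h5 := h2.unique h4
    rw [← inner_closureGradient, inner_add_right, real_inner_smul_right] at h5
    linarith
  have hpar : closureGradient Ω u x =
      (-⟪closureGradient Ω u x, e⟫ * ‖gradient γ x - e‖) • outwardNormal Ω x := by
    refine ext_inner_right ℝ fun d => ?_
    have hne := norm_ne_zero_iff.2 hg.sub_ne_zero
    rw [key d, hν, smul_smul, mul_assoc, mul_inv_cancel₀ hne, mul_one, real_inner_smul_left]
    ring
  have hν1 : ‖outwardNormal Ω x‖ = 1 := by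
    rw [hν, norm_smul, norm_inv, norm_norm, inv_mul_cancel₀ (norm_ne_zero_iff.2 hg.sub_ne_zero)]
  rw [normalDeriv_eq_inner]
  conv_rhs => rw [hpar, real_inner_smul_left, real_inner_self_eq_norm_sq, hν1, one_pow, mul_one]
  exact hpar

end ClosureGradient

/-! ### The Pohozaev field: divergence and flux. -/

section Pohozaev

variable {N : ℕ}

lemma divergence_add {P Q : EuclideanSpace ℝ (Fin N) → EuclideanSpace ℝ (Fin N)}
    {x : EuclideanSpace ℝ (Fin N)} (hP : DifferentiableAt ℝ P x) (hQ : DifferentiableAt ℝ Q x) :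
    divergence (fun y => P y + Q y) x = divergence P x + divergence Q x := by
  rw [divergence, fderiv_fun_add hP hQ]
  exact map_add (LinearMap.trace ℝ (EuclideanSpace ℝ (Fin N))) _ _

lemma divergence_sub {P Q : EuclideanSpace ℝ (Fin N) → EuclideanSpace ℝ (Fin N)}
    {x : EuclideanSpace ℝ (Fin N)} (hP : DifferentiableAt ℝ P x) (hQ : DifferentiableAt ℝ Q x) :
    divergence (fun y => P y - Q y) x = divergence P x - divergence Q x := by
  rw [divergence, fderiv_fun_sub hP hQ]
  exact map_sub (LinearMap.trace ℝ (EuclideanSpace ℝ (Fin N))) _ _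

/-- The Rellich identity for two vector fields with symmetric derivatives. -/
lemma divergence_rellich {p q : EuclideanSpace ℝ (Fin N) → EuclideanSpace ℝ (Fin N)}
    {x : EuclideanSpace ℝ (Fin N)} (hp : DifferentiableAt ℝ p x) (hq : DifferentiableAt ℝ q x)
    (hps : ∀ z w, ⟪fderiv ℝ p x z, w⟫ = ⟪fderiv ℝ p x w, z⟫)
    (hqs : ∀ z w, ⟪fderiv ℝ q x z, w⟫ = ⟪fderiv ℝ q x w, z⟫) :
    divergence (fun y => ⟪y, p y⟫ • q y + ⟪y, q y⟫ • p y - ⟪p y, q y⟫ • y) x =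
      ⟪x, p x⟫ * divergence q x + ⟪x, q x⟫ * divergence p x + (2 - N) * ⟪p x, q x⟫ := by
  have hid := differentiableAt_fun_id (𝕜 := ℝ) (x := x)
  have h1 := hid.inner ℝ hp
  have h2 := hid.inner ℝ hq
  have h3 := hp.inner ℝ hq
  rw [divergence_sub ((h1.fun_smul hq).fun_add (h2.fun_smul hp)) (h3.fun_smul hid),
    divergence_add (h1.fun_smul hq) (h2.fun_smul hp), divergence_smul h1 hq, divergence_smul h2 hp,
    divergence_smul h3 hid, divergence_id, fderiv_inner_apply ℝ hid hp, fderiv_inner_apply ℝ hid hq,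
    fderiv_inner_apply ℝ hp hq]
  have e1 : fderiv ℝ (fun y : EuclideanSpace ℝ (Fin N) => y) x = .id ℝ _ := fderiv_id
  -- By symmetry ⟪Dp(q), x⟫ and ⟪Dq(p), x⟫ cancel the derivative of ⟪p, q⟫ along x. What remains is
  -- one ⟪p, q⟫ from each of the first two fields and −N⟪p, q⟫ from the third.
  have e2 := hps (q x) x
  have e3 := hqs (p x) x
  have e4 := real_inner_comm x (fderiv ℝ p x (q x))
  have e5 := real_inner_comm x (fderiv ℝ q x (p x))
  have e6 := real_inner_comm (p x) (q x)
  have e7 := real_inner_comm (p x) (fderiv ℝ q x x)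
  rw [e1]
  simp only [ContinuousLinearMap.id_apply]
  linarith

lemma hasDerivAt_antideriv {f : ℝ → ℝ} (hf : Continuous f) (t : ℝ) :
    HasDerivAt (antideriv f) (f t) t :=
  (hf.integral_hasStrictDerivAt 0 t).hasDerivAt

lemma contDiff_antideriv {f : ℝ → ℝ} (hf : Continuous f) : ContDiff ℝ 1 (antideriv f) := by
  have h : deriv (antideriv f) = f := funext fun t => (hasDerivAt_antideriv hf t).deriv
  exact contDiff_one_iff_deriv.2
    ⟨fun t => (hasDerivAt_antideriv hf t).differentiableAt, by rwa [h]⟩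

/-- With q = ∇v, the last term is the one that cancels (x·∇v)Δu. -/
lemma divergence_antideriv_smul {f : ℝ → ℝ} (hf : Continuous f) {α : ℝ} (hα : 0 ≤ α)
    {v : EuclideanSpace ℝ (Fin N) → ℝ} {q x : EuclideanSpace ℝ (Fin N)}
    (hv : HasFDerivAt v (innerSL ℝ q) x) :
    divergence (fun y => antideriv f (v y) • (‖y‖ ^ α • y)) x =
      (N + α) * antideriv f (v x) * ‖x‖ ^ α + ‖x‖ ^ α * f (v x) * ⟪x, q⟫ := by
  have h1 : HasFDerivAt (fun y => antideriv f (v y)) (f (v x) • innerSL ℝ q) x :=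
    (hasDerivAt_antideriv hf (v x)).comp_hasFDerivAt x hv
  rw [divergence_smul h1.differentiableAt
    ((contDiff_norm_rpow_smul_self hα).differentiable one_ne_zero x),
    divergence_norm_rpow_smul_self hα, h1.fderiv]
  simp only [smul_apply, innerSL_apply_apply, real_inner_smul_right, smul_eq_mul]
  rw [real_inner_comm]
  ring

lemma divergence_mul_smul {a : ℝ} {v : EuclideanSpace ℝ (Fin N) → ℝ}
    {p : EuclideanSpace ℝ (Fin N) → EuclideanSpace ℝ (Fin N)} {q x : EuclideanSpace ℝ (Fin N)}
    (hv : HasFDerivAt v (innerSL ℝ q) x) (hp : DifferentiableAt ℝ p x) :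
    divergence (fun y => (a * v y) • p y) x = a * (v x * divergence p x + ⟪q, p x⟫) := by
  have h1 : HasFDerivAt (fun y => a * v y) (a • innerSL ℝ q) x := hv.const_mul a
  rw [divergence_smul h1.differentiableAt hp, h1.fderiv]
  simp only [smul_apply, innerSL_apply_apply, smul_eq_mul]
  ring

/-- The vector field whose flux gives the Pohozaev identity. -/
noncomputable def pohozaevField (Ω : Set (EuclideanSpace ℝ (Fin N))) (α β τ : ℝ) (f g : ℝ → ℝ)
    (u v : EuclideanSpace ℝ (Fin N) → ℝ) (x : EuclideanSpace ℝ (Fin N)) :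
    EuclideanSpace ℝ (Fin N) :=
  (⟪x, closureGradient Ω u x⟫ • closureGradient Ω v x
      + ⟪x, closureGradient Ω v x⟫ • closureGradient Ω u x
      - ⟪closureGradient Ω u x, closureGradient Ω v x⟫ • x)
    + (antideriv f (v x) • (‖x‖ ^ α • x) + antideriv g (u x) • (‖x‖ ^ β • x))
    + ((((N : ℝ) - 2) * τ * v x) • closureGradient Ω u x
      + (((N : ℝ) - 2) * (1 - τ) * u x) • closureGradient Ω v x)

variable {Ω : Set (EuclideanSpace ℝ (Fin N))} {α β : ℝ} {f g : ℝ → ℝ}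
  {u v : EuclideanSpace ℝ (Fin N) → ℝ}

lemma contDiffOn_pohozaevField (hΩ : IsOpen Ω) (hα : 0 ≤ α) (hβ : 0 ≤ β)
    (hf : Continuous f) (hg : Continuous g) (huv : IsNonnegSolution Ω α β f g u v) (τ : ℝ) :
    ContDiffOn ℝ 1 (pohozaevField Ω α β τ f g u v) Ω := by
  have hp := contDiffOn_closureGradient hΩ huv.contDiffOn_u
  have hq := contDiffOn_closureGradient hΩ huv.contDiffOn_v
  have hu : ContDiffOn ℝ 1 u Ω := huv.contDiffOn_u.of_le (by norm_num)
  have hv : ContDiffOn ℝ 1 v Ω := huv.contDiffOn_v.of_le (by norm_num)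
  have hid : ContDiffOn ℝ 1 (fun x : EuclideanSpace ℝ (Fin N) => x) Ω := contDiffOn_id
  have hF := (contDiff_antideriv hf).comp_contDiffOn hv
  have hG := (contDiff_antideriv hg).comp_contDiffOn hu
  exact (((((hid.inner ℝ hp).smul hq).add ((hid.inner ℝ hq).smul hp)).sub
    ((hp.inner ℝ hq).smul hid)).add
    ((hF.smul (contDiff_norm_rpow_smul_self hα).contDiffOn).add
      (hG.smul (contDiff_norm_rpow_smul_self hβ).contDiffOn))).add
    (((contDiffOn_const.mul hv).smul hp).add ((contDiffOn_const.mul hu).smul hq))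

lemma continuousOn_pohozaevField (hΩ : IsOpen Ω) (hC1 : HasC1Boundary Ω) (hα : 0 ≤ α)
    (hβ : 0 ≤ β) (hf : Continuous f) (hg : Continuous g)
    (huv : IsNonnegSolution Ω α β f g u v) (τ : ℝ) :
    ContinuousOn (pohozaevField Ω α β τ f g u v) (closure Ω) := by
  have hp := continuousOn_closureGradient hΩ hC1 huv.contDiffOn_closure_u
  have hq := continuousOn_closureGradient hΩ hC1 huv.contDiffOn_closure_v
  have hu := huv.contDiffOn_closure_u.continuousOn
  have hv := huv.contDiffOn_closure_v.continuousOn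
  have hid : ContinuousOn (fun x : EuclideanSpace ℝ (Fin N) => x) (closure Ω) := continuousOn_id
  have hF : ContinuousOn (fun x => antideriv f (v x)) (closure Ω) :=
    (contDiff_antideriv hf).continuous.comp_continuousOn hv
  have hG : ContinuousOn (fun x => antideriv g (u x)) (closure Ω) :=
    (contDiff_antideriv hg).continuous.comp_continuousOn hu
  have hX := (contDiff_norm_rpow_smul_self (N := N) hα).continuous
  have hY := (contDiff_norm_rpow_smul_self (N := N) hβ).continuous
  unfold pohozaevField
  fun_prop

lemma divergence_pohozaevField (hΩ : IsOpen Ω) (hα : 0 ≤ α) (hβ : 0 ≤ β)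
    (hf : Continuous f) (hg : Continuous g) (huv : IsNonnegSolution Ω α β f g u v) (τ : ℝ)
    {x : EuclideanSpace ℝ (Fin N)} (hx : x ∈ Ω) :
    divergence (pohozaevField Ω α β τ f g u v) x =
      (((N : ℝ) + α) * antideriv f (v x) - ((N : ℝ) - 2) * τ * (v x * f (v x))) * ‖x‖ ^ α
        + (((N : ℝ) + β) * antideriv g (u x) - ((N : ℝ) - 2) * (1 - τ) * (u x * g (u x)))
          * ‖x‖ ^ β := by
  have hp := ((contDiffOn_closureGradient hΩ huv.contDiffOn_u).contDiffAt
    (hΩ.mem_nhds hx)).differentiableAt one_ne_zero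
  have hq := ((contDiffOn_closureGradient hΩ huv.contDiffOn_v).contDiffAt
    (hΩ.mem_nhds hx)).differentiableAt one_ne_zero
  have hu := hasFDerivAt_of_mem hΩ huv.contDiffOn_u hx
  have hv := hasFDerivAt_of_mem hΩ huv.contDiffOn_v hx
  have hid := differentiableAt_fun_id (𝕜 := ℝ) (x := x)
  have hF : DifferentiableAt ℝ (fun y => antideriv f (v y)) x :=
    ((contDiff_antideriv hf).differentiable one_ne_zero _).comp x hv.differentiableAt
  have hG : DifferentiableAt ℝ (fun y => antideriv g (u y)) x :=
    ((contDiff_antideriv hg).differentiable one_ne_zero _).comp x hu.differentiableAt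
  have d1 := (((hid.inner ℝ hp).smul hq).add ((hid.inner ℝ hq).smul hp)).sub
    ((hp.inner ℝ hq).smul hid)
  have d2 := hF.smul ((contDiff_norm_rpow_smul_self hα).differentiable one_ne_zero x)
  have d3 := hG.smul ((contDiff_norm_rpow_smul_self hβ).differentiable one_ne_zero x)
  have d4 := (hv.differentiableAt.const_mul (((N : ℝ) - 2) * τ)).smul hp
  have d5 := (hu.differentiableAt.const_mul (((N : ℝ) - 2) * (1 - τ))).smul hq
  have hsum := divergence_add (d1.add (d2.add d3)) (d4.add d5)
  rw [show pohozaevField Ω α β τ f g u v = fun y => _ from rfl]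
  refine hsum.trans ?_
  have e1 := divergence_add d1 (d2.add d3)
  have e2 := divergence_add d2 d3
  have e3 := divergence_add d4 d5
  have e4 := divergence_rellich hp hq
    (inner_fderiv_closureGradient_symm hΩ huv.contDiffOn_u hx)
    (inner_fderiv_closureGradient_symm hΩ huv.contDiffOn_v hx)
  have e5 := divergence_antideriv_smul hf hα hv
  have e6 := divergence_antideriv_smul hg hβ hu
  have e7 := divergence_mul_smul (a := ((N : ℝ) - 2) * τ) hv hp
  have e8 := divergence_mul_smul (a := ((N : ℝ) - 2) * (1 - τ)) hu hq
  have e9 := divergence_closureGradient hΩ huv.contDiffOn_u hx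
  have e10 := divergence_closureGradient hΩ huv.contDiffOn_v hx
  have e11 : (Δ u) x = -(‖x‖ ^ α * f (v x)) := by linarith [huv.eq_u x hx]
  have e12 : (Δ v) x = -(‖x‖ ^ β * g (u x)) := by linarith [huv.eq_v x hx]
  rw [e9, e11] at e4 e7
  rw [e10, e12] at e4 e8
  rw [real_inner_comm] at e7
  refine (congrArg₂ (· + ·) (e1.trans (congrArg₂ (· + ·) e4
    (e2.trans (congrArg₂ (· + ·) e5 e6)))) (e3.trans (congrArg₂ (· + ·) e7 e8))).trans ?_
  ring

/-- Since u, v, F(0) and G(0) vanish, only the Rellich part survives; with both gradients normal,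
its three terms contribute 1 + 1 − 1 copies of the flux. -/
lemma inner_pohozaevField_outwardNormal (hΩ : IsOpen Ω) (hC1 : HasC1Boundary Ω)
    (huv : IsNonnegSolution Ω α β f g u v) (τ : ℝ)
    {x : EuclideanSpace ℝ (Fin N)} (hx : x ∈ frontier Ω) :
    ⟪pohozaevField Ω α β τ f g u v x, outwardNormal Ω x⟫ =
      ⟪x, outwardNormal Ω x⟫ * normalDeriv Ω u x * normalDeriv Ω v x := by
  have hν : ⟪outwardNormal Ω x, outwardNormal Ω x⟫ = 1 := by
    obtain ⟨e, γ, hg, hn⟩ := hC1.isOutwardUnitNormal hx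
    rw [real_inner_self_eq_norm_sq, hn, norm_smul, norm_inv, norm_norm,
      inv_mul_cancel₀ (norm_ne_zero_iff.2 hg.sub_ne_zero), one_pow]
  have h0 : ∀ k : ℝ → ℝ, antideriv k 0 = 0 := fun k => intervalIntegral.integral_same
  rw [pohozaevField, huv.boundary_u x hx, huv.boundary_v x hx, h0, h0,
    closureGradient_eq_smul_normal hΩ hC1 huv.contDiffOn_closure_u huv.boundary_u hx,
    closureGradient_eq_smul_normal hΩ hC1 huv.contDiffOn_closure_v huv.boundary_v hx]
  simp only [mul_zero, zero_smul, add_zero, inner_add_left, inner_sub_left,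
    real_inner_smul_left, real_inner_smul_right, hν]
  ring

lemma continuousOn_pohozaev_integrand (hα : 0 ≤ α) (hf : Continuous f) (a b : ℝ)
    (hv : ContinuousOn v (closure Ω)) :
    ContinuousOn (fun x => (a * antideriv f (v x) - b * (v x * f (v x))) * ‖x‖ ^ α)
      (closure Ω) := by
  have h1 : Continuous fun x : EuclideanSpace ℝ (Fin N) => ‖x‖ ^ α :=
    continuous_norm.rpow_const fun _ => Or.inr hα
  have h2 := (contDiff_antideriv hf).continuous.comp_continuousOn hv
  have h3 := hf.comp_continuousOn hv
  exact ((continuousOn_const.mul h2).sub (continuousOn_const.mul (hv.mul h3))).mul h1.continuousOn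

end Pohozaev

end WeightedElliptic

theorem mainTheorem8 (N : ℕ) (hN : 1 ≤ N) (Ω : Set (EuclideanSpace ℝ (Fin N)))
    (hΩ_open : IsOpen Ω) (hΩ_conn : IsConnected Ω) (hΩ_bdd : Bornology.IsBounded Ω)
    (hΩ_C1 : WeightedElliptic.HasC1Boundary Ω)
    (α β : ℝ) (hα : 0 ≤ α) (hβ : 0 ≤ β)
    (f g : ℝ → ℝ) (hf : ContDiff ℝ 1 f) (hg : ContDiff ℝ 1 g)
    (u v : EuclideanSpace ℝ (Fin N) → ℝ)
    (huv : WeightedElliptic.IsNonnegSolution Ω α β f g u v)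
    (τ : ℝ) (hτ : τ ∈ Set.Icc (0 : ℝ) 1) :
    MeasureTheory.IntegrableOn (fun x => (((N : ℝ) + α) * WeightedElliptic.antideriv f (v x)
        - ((N : ℝ) - 2) * τ * (v x * f (v x))) * ‖x‖ ^ α) Ω ∧
    MeasureTheory.IntegrableOn (fun x => (((N : ℝ) + β) * WeightedElliptic.antideriv g (u x)
        - ((N : ℝ) - 2) * (1 - τ) * (u x * g (u x))) * ‖x‖ ^ β) Ω ∧
    MeasureTheory.IntegrableOn (fun x => ⟪x, WeightedElliptic.outwardNormal Ω x⟫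
        * WeightedElliptic.normalDeriv Ω u x * WeightedElliptic.normalDeriv Ω v x)
      (frontier Ω) μHE[N - 1] ∧
    (∫ x in Ω, (((N : ℝ) + α) * WeightedElliptic.antideriv f (v x)
        - ((N : ℝ) - 2) * τ * (v x * f (v x))) * ‖x‖ ^ α)
      + (∫ x in Ω, (((N : ℝ) + β) * WeightedElliptic.antideriv g (u x)
        - ((N : ℝ) - 2) * (1 - τ) * (u x * g (u x))) * ‖x‖ ^ β)
      = ∫ x in frontier Ω, ⟪x, WeightedElliptic.outwardNormal Ω x⟫
        * WeightedElliptic.normalDeriv Ω u x * WeightedElliptic.normalDeriv Ω v x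
          ∂μHE[N - 1] := by
  have c1 := WeightedElliptic.continuousOn_pohozaev_integrand hα hf.continuous ((N : ℝ) + α)
    (((N : ℝ) - 2) * τ) huv.contDiffOn_closure_v.continuousOn
  have c2 := WeightedElliptic.continuousOn_pohozaev_integrand hβ hg.continuous ((N : ℝ) + β)
    (((N : ℝ) - 2) * (1 - τ)) huv.contDiffOn_closure_u.continuousOn
  have i1 := WeightedElliptic.integrableOn_of_continuousOn_closure hΩ_bdd c1
  have i2 := WeightedElliptic.integrableOn_of_continuousOn_closure hΩ_bdd c2
  have hQc := WeightedElliptic.continuousOn_pohozaevField hΩ_open hΩ_C1 hα hβ hf.continuous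
    hg.continuous huv τ
  have hflux := fun x hx =>
    WeightedElliptic.inner_pohozaevField_outwardNormal hΩ_open hΩ_C1 huv τ (x := x) hx
  -- The boundary integrand inherits integrability from Q·ν, which is continuous on a compact set of
  -- finite surface measure.
  have i3 := WeightedElliptic.integrableOn_frontier hΩ_open hΩ_bdd hΩ_C1
    ((hQc.mono frontier_subset_closure).inner
      (WeightedElliptic.continuousOn_outwardNormal hΩ_C1))
  refine ⟨i1, i2, i3.congr_fun hflux isClosed_frontier.measurableSet, ?_⟩
  rw [← MeasureTheory.integral_add i1 i2,
    ← MeasureTheory.setIntegral_congr_fun isClosed_frontier.measurableSet hflux]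
  exact WeightedElliptic.integral_divergence_eq_integral_frontier hΩ_open hΩ_bdd hΩ_C1
    (WeightedElliptic.contDiffOn_pohozaevField hΩ_open hα hβ hf.continuous hg.continuous huv τ)
    hQc (c1.add c2) fun x hx => WeightedElliptic.divergence_pohozaevField hΩ_open hα hβ
      hf.continuous hg.continuous huv τ hx
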